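/- Let $\pi:P\to M$ be a smooth principal circle bundle (circle group $U(1)$, manifolds finite-dimensional and without boundary) with a connection $1$-form $\Theta$, i.e. a smooth $U(1)$-invariant $i\mathbb{R}$-valued $1$-form with $\Theta(\partial_\theta)=2\pi i$, where $\partial_\theta$ at $p$ is the velocity of $\theta\mapsto e^{2\pi i\theta}p$ at $\theta=0$. Let $L\to M$ be a Hermitian line bundle whose bundle of unit vectors is $P$, and let $\nabla^L$ be the connection corresponding to $\Theta$: if $s:U\to P$ is a smooth local section over an open set $U\subset M$ and $f$ is the corresponding local unit frame of $L$, then $\nabla^L f=s^*\Theta\otimes f$. For $n\in\mathbb{Z}$ the induced operator on complex differential forms on $M$ with values in $L^{\otimes n}$ is thus $\nabla^{L^{\otimes n}}(a\otimes f^{\otimes n})=(da+n\,s^*\Theta\wedge a)\otimes f^{\otimes n}$ on $U$. For a smooth complex (possibly inhomogeneous) differential form $\omega$ on $P$, the twisted integral along the fibre $\int^{P/M,n}\omega$ is given over $U$ as follows. In the coordinates $(y,\theta)\mapsto e^{2\pi i\theta}s(y)$ on $\pi^{-1}(U)$ write $\omega=d\theta\wedge\beta+\gamma$, where $\beta,\gamma$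 do not contain $d\theta$, and put $$\Big(\int^{P/M,n}\omega\Big)\Big|_U=\Big(\int_0^1\beta\,e^{2\pi i n\theta}\,d\theta\Big)\otimes f^{\otimes n}.$$ Then, for every $n\in\mathbb{Z}$ and every such $\omega$, these local expressions do not depend on the choice of $s$, and $\int^{P/M,n}\omega$ is a smooth differential form on $M$ with values in $L^{\otimes n}$; likewise the local expressions above of $\nabla^{L^{\otimes n}}\int^{P/M,n}\omega$ do not depend on the choice of $s$. Moreover, let $Y$ be a smooth vector field on $M$, let $\widetilde Y$ be any smooth lift of $Y$ to $P$ (that is, $d\pi(\widetilde Y)=Y\circ\pi$), and let $H$ be a smooth complex differential form on $M$ all of whose homogeneous components have odd degree. Then $$(\nabla^{L^{\otimes n}}-\iota_Y+H)\int^{P/M,n}\omega=-\int^{P/M,n}(d+n\Theta-\iota_{\widetilde Y}+H)\,\omega ,$$ where $\Theta$ and $H$ act by left exterior multiplication, and $H$ acts on forms on $P$ through its pullback $\pi^*H$. -/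

import Mathlib

open scoped Manifold ContDiff TensorProduct Topology
open Bundle

noncomputable section

namespace ExoticForms

/-! ### Alternating forms -/

section Algebra

variable {E : Type*} [NormedAddCommGroup E] [NormedSpace ℝ E] {i j k : ℕ}

theorem mul'_summand (α : E [⋀^Fin i]→ₗ[ℝ] ℂ) (β : E [⋀^Fin j]→ₗ[ℝ] ℂ)
    (σ : Equiv.Perm (Fin i ⊕ Fin j)) (v : Fin i ⊕ Fin j → E) :
    LinearMap.mul' ℝ ℂ (AlternatingMap.domCoprod.summand α β (Quotient.mk'' σ) v) =
      Equiv.Perm.sign σ • (α (fun a => v (σ (Sum.inl a))) * β (fun b => v (σ (Sum.inr b)))) := by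
  rw [AlternatingMap.domCoprod.summand_mk'', _root_.smul_apply]
  simp only [Units.smul_def, map_zsmul]
  rfl

/-- The wedge product of a complex-valued alternating `i`-form and a complex-valued alternating
`j`-form, where `i + j = k`: the signed sum over the `(i, j)`-shuffles of the products of the
values. In particular `(α ∧ β)(v, w) = α(v) β(w) - α(w) β(v)` for two `1`-forms. -/
def wedge (h : i + j = k) (α : E [⋀^Fin i]→L[ℝ] ℂ) (β : E [⋀^Fin j]→L[ℝ] ℂ) :
    E [⋀^Fin k]→L[ℝ] ℂ :=
  { ((LinearMap.mul' ℝ ℂ).compAlternatingMap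
      (α.toAlternatingMap.domCoprod β.toAlternatingMap)).domDomCongr
        (finSumFinEquiv.trans (finCongr h)) with
    cont := by
      change Continuous fun v : Fin k → E =>
        LinearMap.mul' ℝ ℂ ((α.toAlternatingMap.domCoprod β.toAlternatingMap)
          fun a => v ((finSumFinEquiv.trans (finCongr h)) a))
      simp only [AlternatingMap.domCoprod_apply, _root_.sum_apply, map_sum]
      refine continuous_finsetSum _ fun σ _ => ?_
      induction σ using Quotient.inductionOn' with | _ σ
      simp only [mul'_summand]
      refine Continuous.const_smul (Continuous.mul ?_ ?_) _
      · exact α.cont.comp (by fun_prop)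
      · exact β.cont.comp (by fun_prop) }

theorem wedge_apply (h : i + j = k) (α : E [⋀^Fin i]→L[ℝ] ℂ) (β : E [⋀^Fin j]→L[ℝ] ℂ)
    (v : Fin k → E) :
    wedge h α β v = ∑ σ : Equiv.Perm.ModSumCongr (Fin i) (Fin j),
      LinearMap.mul' ℝ ℂ (AlternatingMap.domCoprod.summand α.toAlternatingMap β.toAlternatingMap σ
        fun a => v ((finSumFinEquiv.trans (finCongr h)) a)) := by
  rw [← map_sum, ← _root_.sum_apply]
  rfl

/-- `β ↦ α ∧ β` as a complex linear map. -/
def wedgeLeft (h : i + j = k) (α : E [⋀^Fin i]→L[ℝ] ℂ) :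
    (E [⋀^Fin j]→L[ℝ] ℂ) →ₗ[ℂ] (E [⋀^Fin k]→L[ℝ] ℂ) where
  toFun β := wedge h α β
  map_add' β γ := by
    ext v
    rw [ContinuousAlternatingMap.add_apply]
    simp only [wedge_apply, ← Finset.sum_add_distrib]
    refine Finset.sum_congr rfl fun σ _ => ?_
    induction σ using Quotient.inductionOn' with | _ σ
    simp only [mul'_summand, ← smul_add, ← mul_add]
    rfl
  map_smul' c β := by
    ext v
    rw [ContinuousAlternatingMap.smul_apply]
    simp only [wedge_apply, Finset.smul_sum]
    refine Finset.sum_congr rfl fun σ _ => ?_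
    induction σ using Quotient.inductionOn' with | _ σ
    simp only [mul'_summand, RingHom.id_apply, Units.smul_def]
    rw [smul_comm c]
    exact congrArg _ (mul_smul_comm c _ _)

/-- The contraction `α ↦ ι_u α = α(u, ·, …, ·)` as a complex linear map. -/
def contract (u : E) : (E [⋀^Fin (k + 1)]→L[ℝ] ℂ) →ₗ[ℂ] (E [⋀^Fin k]→L[ℝ] ℂ) where
  toFun α := α.curryLeft u
  map_add' _ _ := rfl
  map_smul' _ _ := rfl

end Algebra

/-! ### Differential forms on manifolds

All manifolds are modelled on a finite-dimensional real normed space `E` through the model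
`𝓘(ℝ, E)` (so they have no boundary). In Mathlib the tangent space `TangentSpace 𝓘(ℝ, E) x` is by
definition `E`, hence a complex-valued differential `k`-form is a map from `M` to the alternating
`k`-forms on `E`. -/

section Forms

variable {E : Type*} [NormedAddCommGroup E] [NormedSpace ℝ E]
  {M : Type*} [TopologicalSpace M] [ChartedSpace E M]
  {E' : Type*} [NormedAddCommGroup E'] [NormedSpace ℝ E']
  {P : Type*} [TopologicalSpace P] [ChartedSpace E' P]

variable (E M) in
/-- Complex-valued differential `k`-forms on `M`, without any regularity. -/
abbrev Form (k : ℕ) : Type _ := M → E [⋀^Fin k]→L[ℝ] ℂ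

variable (E M) in
/-- Inhomogeneous complex-valued differential forms on `M`: a form in each degree. -/
abbrev TotalForm : Type _ := (k : ℕ) → Form E M k

/-- The differential of a map between manifolds, as a linear map of the model spaces. -/
def tangentMapAt (f : M → P) (x : M) : E →L[ℝ] E' := mfderiv 𝓘(ℝ, E) 𝓘(ℝ, E') f x

/-- The pullback `f^* α`. -/
def pullback {k : ℕ} (f : M → P) (α : Form E' P k) : Form E M k :=
  fun x => (α (f x)).compContinuousLinearMap (tangentMapAt f x)

/-- The expression of a form in the preferred chart at `x₀` (pullback by the inverse chart). -/
def chartExpr {k : ℕ} (x₀ : M) (α : Form E M k) : E → E [⋀^Fin k]→L[ℝ] ℂ :=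
  pullback (M := E) (E := E) (extChartAt 𝓘(ℝ, E) x₀).symm α

/-- `α` is smooth on the open set `U`: its chart expressions are smooth. -/
def IsSmoothOn {k : ℕ} (α : Form E M k) (U : Set M) : Prop :=
  ∀ x₀ : M, ContDiffOn ℝ ∞ (chartExpr x₀ α)
    ((extChartAt 𝓘(ℝ, E) x₀).target ∩ (extChartAt 𝓘(ℝ, E) x₀).symm ⁻¹' U)

/-- Smoothness of an inhomogeneous form. -/
def TotalForm.IsSmooth (α : TotalForm E M) : Prop := ∀ k, IsSmoothOn (α k) Set.univ

/-- The exterior derivative of a form at `x`, computed in the chart at `x`. -/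
def extDer {k : ℕ} (α : Form E M k) : Form E M (k + 1) :=
  fun x => (extDeriv (chartExpr x α) (extChartAt 𝓘(ℝ, E) x x)).compContinuousLinearMap
    (tangentMapAt (P := E) (E' := E) (extChartAt 𝓘(ℝ, E) x) x)

/-- The exterior derivative of an inhomogeneous form. -/
def TotalForm.d (α : TotalForm E M) : TotalForm E M
  | 0 => 0
  | k + 1 => extDer (α k)

/-- The contraction `ι_Y α` of an inhomogeneous form with a vector field. -/
def TotalForm.contract (Y : M → E) (α : TotalForm E M) : TotalForm E M :=
  fun k x => ExoticForms.contract (Y x) (α (k + 1) x)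

/-- The wedge product of two inhomogeneous forms. -/
def TotalForm.wedge (α β : TotalForm E M) : TotalForm E M :=
  fun k x => ∑ i : Fin (k + 1),
    ExoticForms.wedge (Nat.add_sub_of_le (Nat.le_of_lt_succ i.2)) (α i x) (β (k - i) x)

/-- The wedge product `θ ∧ α` of a `1`-form and an inhomogeneous form. -/
def oneWedge (θ : Form E M 1) (α : TotalForm E M) : TotalForm E M
  | 0 => 0
  | k + 1 => fun x => ExoticForms.wedge (Nat.add_comm 1 k) (θ x) (α k x)

/-- The pullback of an inhomogeneous form. -/
def TotalForm.pullback (f : M → P) (α : TotalForm E' P) : TotalForm E M :=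
  fun k => ExoticForms.pullback f (α k)

/-- Smooth vector fields on `M`. -/
def IsSmoothVectorField [IsManifold 𝓘(ℝ, E) ∞ M] (Y : M → E) : Prop :=
  ContMDiff 𝓘(ℝ, E) 𝓘(ℝ, E).tangent ∞
    (fun x => (⟨x, Y x⟩ : TangentBundle 𝓘(ℝ, E) M))

end Forms

/-! ### Integral tensor powers of a complex line -/

section Powers

/-- The tensor power `V^{⊗n}`, `n ∈ ℤ`, of a complex line `V`; for `n < 0` it is the `(-n)`-th
tensor power of the dual. -/
def TensorZPow (V : Type*) [AddCommGroup V] [Module ℂ V] : ℤ → Type _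
  | .ofNat n => PiTensorProduct ℂ (fun _ : Fin n => V)
  | .negSucc n => PiTensorProduct ℂ (fun _ : Fin (n + 1) => Module.Dual ℂ V)

instance (V : Type*) [AddCommGroup V] [Module ℂ V] : (n : ℤ) → AddCommGroup (TensorZPow V n)
  | .ofNat n => inferInstanceAs (AddCommGroup (PiTensorProduct ℂ (fun _ : Fin n => V)))
  | .negSucc n => inferInstanceAs
      (AddCommGroup (PiTensorProduct ℂ (fun _ : Fin (n + 1) => Module.Dual ℂ V)))

instance (V : Type*) [AddCommGroup V] [Module ℂ V] : (n : ℤ) → Module ℂ (TensorZPow V n)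
  | .ofNat n => inferInstanceAs (Module ℂ (PiTensorProduct ℂ (fun _ : Fin n => V)))
  | .negSucc n => inferInstanceAs
      (Module ℂ (PiTensorProduct ℂ (fun _ : Fin (n + 1) => Module.Dual ℂ V)))

variable {V : Type*} [NormedAddCommGroup V] [InnerProductSpace ℂ V]

/-- The linear form `⟪v, ·⟫`; for a unit vector `v` of a Hermitian line it is the dual basis of
`v`. -/
def dualVec (v : V) : Module.Dual ℂ V := (innerSL ℂ v).toLinearMap

/-- The vector `v^{⊗n}` of `V^{⊗n}` for a unit vector `v` of a Hermitian line; for `n < 0` it is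
the `(-n)`-th tensor power of the dual basis of `v`. -/
def tpow (v : V) : (n : ℤ) → TensorZPow V n
  | .ofNat n => PiTensorProduct.tprod ℂ (fun _ : Fin n => v)
  | .negSucc n => PiTensorProduct.tprod ℂ (fun _ : Fin (n + 1) => dualVec v)

/-- The coordinate on `V^{⊗n}` with respect to the basis `v^{⊗n}`, for a unit vector `v` of a
Hermitian line `V`. -/
def tcoord (v : V) : (n : ℤ) → TensorZPow V n →ₗ[ℂ] ℂ
  | .ofNat n => PiTensorProduct.lift
      ((MultilinearMap.mkPiAlgebra ℂ (Fin n) ℂ).compLinearMap fun _ => dualVec v)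
  | .negSucc n => PiTensorProduct.lift
      ((MultilinearMap.mkPiAlgebra ℂ (Fin (n + 1)) ℂ).compLinearMap
        fun _ => Module.Dual.eval ℂ V v)

theorem tcoord_tpow (v : V) (hv : ‖v‖ = 1) (n : ℤ) : tcoord v n (tpow v n) = 1 := by
  have h : dualVec v v = 1 := by simp [dualVec, hv]
  cases n with
  | ofNat n =>
    refine (PiTensorProduct.lift.tprod _).trans ?_
    simp [h]
  | negSucc n =>
    refine (PiTensorProduct.lift.tprod _).trans ?_
    simp [h]

end Powers

/-! ### Principal circle bundles, connections and their Hermitian line bundles -/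

section Bundles

variable {E : Type*} [NormedAddCommGroup E] [NormedSpace ℝ E]
  {M : Type*} [TopologicalSpace M] [ChartedSpace E M]
  {E' : Type*} [NormedAddCommGroup E'] [NormedSpace ℝ E']
  {P : Type*} [TopologicalSpace P] [ChartedSpace E' P] [MulAction Circle P]

variable (E E') in
/-- `pr : P → M` is a smooth principal circle bundle for the given action of the circle on `P`: the
action is smooth and preserves the fibres, and `pr` has smooth equivariant local trivializations
`pr⁻¹(U) ≅ U × Circle`. (The circle is abelian, so left and right actions are the same.) -/
structure IsPrincipalCircleBundle (pr : P → M) : Prop where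
  smooth_smul : ContMDiff ((𝓡 1).prod 𝓘(ℝ, E')) 𝓘(ℝ, E') ∞ fun q : Circle × P => q.1 • q.2
  proj_smul : ∀ (u : Circle) (p : P), pr (u • p) = pr p
  exists_trivialization : ∀ x : M, ∃ e : Trivialization Circle pr, x ∈ e.baseSet ∧
    ContMDiffOn 𝓘(ℝ, E') (𝓘(ℝ, E).prod (𝓡 1)) ∞ e e.source ∧
    ContMDiffOn (𝓘(ℝ, E).prod (𝓡 1)) 𝓘(ℝ, E') ∞ e.toOpenPartialHomeomorph.symm e.target ∧
    ∀ (u : Circle) (p : P), p ∈ e.source → e (u • p) = ((e p).1, u * (e p).2)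

variable (E E') in
/-- A smooth section of `pr : P → M` over an open set `U`. For a principal bundle this is the same
thing as a local trivialization over `U` (the section being the points with second coordinate
`1 ∈ Circle`). -/
structure LocalSection (pr : P → M) where
  U : Set M
  isOpen : IsOpen U
  toFun : M → P
  smooth : ContMDiffOn 𝓘(ℝ, E) 𝓘(ℝ, E') ∞ toFun U
  proj : ∀ x ∈ U, pr (toFun x) = x

theorem IsPrincipalCircleBundle.exists_localSection {pr : P → M}
    (hpr : IsPrincipalCircleBundle E E' pr) (x : M) : ∃ s : LocalSection E E' pr, x ∈ s.U := by
  obtain ⟨e, hx, -, he, -⟩ := hpr.exists_trivialization x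
  refine ⟨⟨e.baseSet, e.open_baseSet, fun y => e.toOpenPartialHomeomorph.symm (y, 1), ?_, ?_⟩, hx⟩
  · refine he.comp (f := fun y : M => (y, (1 : Circle))) ?_ ?_
    · exact (contMDiff_id.prodMk contMDiff_const).contMDiffOn
    · intro y hy
      simpa [e.target_eq] using hy
  · intro y hy
    exact e.proj_symm_apply' hy

/-- A local section near `x`. -/
def IsPrincipalCircleBundle.localSection {pr : P → M} (hpr : IsPrincipalCircleBundle E E' pr)
    (x : M) : LocalSection E E' pr := (hpr.exists_localSection x).choose

/-- The fibre through `p`, parametrized by the vertical coordinate `t` (of period `1`):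
`t ↦ e^{2prit} p`. -/
def rot (t : ℝ) (p : P) : P := Circle.exp (2 * Real.pi * t) • p

/-- The vertical vector field `∂/∂t` on `P`, the velocity of `t ↦ e^{2prit} p` at `t = 0`. -/
def vert (p : P) : E' := mfderiv 𝓘(ℝ, ℝ) 𝓘(ℝ, E') (fun t : ℝ => rot t p) 0 (1 : ℝ)

/-- `Θ` is a connection `1`-form on the circle bundle `P`: it is smooth, takes values in the Lie
algebra `iℝ` of the circle, is invariant under the circle action, and reproduces the generators of
the action, so that `Θ(∂/∂t) = 2pri`. -/
structure IsConnectionForm (Θ : Form E' P 1) : Prop where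
  smooth : IsSmoothOn Θ Set.univ
  re_eq_zero : ∀ (p : P) (v : Fin 1 → E'), (Θ p v).re = 0
  invariant : ∀ u : Circle, pullback (fun p : P => u • p) Θ = Θ
  vert : ∀ p : P, Θ p (fun _ => ExoticForms.vert p) = 2 * Real.pi * Complex.I

variable {L : M → Type*} [∀ x, NormedAddCommGroup (L x)] [∀ x, InnerProductSpace ℂ (L x)]
  [TopologicalSpace (TotalSpace ℂ L)] [FiberBundle ℂ L]

variable (E E' L) in
/-- An identification of the principal circle bundle `P` with the circle bundle (the bundle of unit
vectors) of the Hermitian line bundle `L`: a smooth map from `P` to the total space of `L` over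
`M`, which is equivariant and takes values in the unit vectors. (As the fibres of `L` are complex
lines, it is then automatically a bijection of `P` with the unit circle bundle.) -/
structure CircleBundleIso (pr : P → M) where
  vec : ∀ p : P, L (pr p)
  norm_vec : ∀ p, ‖vec p‖ = 1
  vec_smul : ∀ (u : Circle) (p : P),
    (⟨pr (u • p), vec (u • p)⟩ : TotalSpace ℂ L) = ⟨pr p, (u : ℂ) • vec p⟩
  smooth : ContMDiff 𝓘(ℝ, E') (𝓘(ℝ, E).prod 𝓘(ℝ, ℂ)) ∞
    fun p : P => (⟨pr p, vec p⟩ : TotalSpace ℂ L)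

open Classical in
/-- The local unit frame `f` of `L` which corresponds to a local section `s` of `P`
(with value `0` outside the domain of the section). -/
def CircleBundleIso.frame {pr : P → M} (j : CircleBundleIso E E' L pr)
    (s : LocalSection E E' pr) (x : M) : L x :=
  if h : pr (s.toFun x) = x then h ▸ j.vec (s.toFun x) else 0

/-! ### Forms with values in `L^{⊗n}` -/

variable (E L) in
/-- Inhomogeneous differential forms on `M` with values in `L^{⊗n}`: in each degree `k`, a section
of `Λ^k T^*M ⊗ L^{⊗n}`, without any regularity. -/
abbrev LForm (n : ℤ) : Type _ :=
  (k : ℕ) → (x : M) → (E [⋀^Fin k]→L[ℝ] ℂ) ⊗[ℂ] TensorZPow (L x) n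

/-- The coefficient form `a` of `η = a ⊗ f^{⊗n}`, where `f` is the frame of `L` given by the local
section `s`. -/
def coeffForm {pr : P → M} (j : CircleBundleIso E E' L pr) {n : ℤ} (s : LocalSection E E' pr)
    (η : LForm E L n) : TotalForm E M :=
  fun k x => TensorProduct.rid ℂ (E [⋀^Fin k]→L[ℝ] ℂ)
    ((tcoord (j.frame s x) n).lTensor (E [⋀^Fin k]→L[ℝ] ℂ) (η k x))

/-- `η` is smooth: its coefficients in the local frames are smooth forms. -/
def LForm.IsSmooth {pr : P → M} (j : CircleBundleIso E E' L pr) {n : ℤ} (η : LForm E L n) : Prop :=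
  ∀ (s : LocalSection E E' pr) (k : ℕ), IsSmoothOn (coeffForm j s η k) s.U

/-- The contraction `ι_Y` on forms with values in `L^{⊗n}`. -/
def LForm.contract {n : ℤ} (Y : M → E) (η : LForm E L n) : LForm E L n :=
  fun k x => (ExoticForms.contract (Y x)).rTensor (TensorZPow (L x) n) (η (k + 1) x)

/-- The product `H ∧ η` of a scalar form and a form with values in `L^{⊗n}`. -/
def LForm.wedge {n : ℤ} (H : TotalForm E M) (η : LForm E L n) : LForm E L n :=
  fun k x => ∑ i : Fin (k + 1),
    (wedgeLeft (Nat.add_sub_of_le (Nat.le_of_lt_succ i.2)) (H i x)).rTensor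
      (TensorZPow (L x) n) (η (k - i) x)

/-- The connection on `L^{⊗n}`, extended to forms with values in `L^{⊗n}`, in the frame `f` of `L`
given by the local section `s`. The connection of `L` which corresponds to `Θ` is `∇ f = s^*Θ ⊗ f`;
hence `∇ (a ⊗ f^{⊗n}) = (da + n s^*Θ ∧ a) ⊗ f^{⊗n}`. -/
def covDerIn {pr : P → M} (j : CircleBundleIso E E' L pr) (Θ : Form E' P 1) {n : ℤ}
    (s : LocalSection E E' pr) (η : LForm E L n) : LForm E L n :=
  fun k x =>
    ((coeffForm j s η).d k x + (n : ℂ) • oneWedge (pullback s.toFun Θ) (coeffForm j s η) k x)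
      ⊗ₜ[ℂ] tpow (j.frame s x) n

/-- The covariant derivative `∇^{L^{⊗n}}` on forms with values in `L^{⊗n}`, computed at each point
in a local frame near that point. -/
def covDer {pr : P → M} (hpr : IsPrincipalCircleBundle E E' pr) (j : CircleBundleIso E E' L pr)
    (Θ : Form E' P 1) {n : ℤ} (η : LForm E L n) : LForm E L n :=
  fun k x => covDerIn j Θ (hpr.localSection x) η k x

/-! ### Twisted integration along the fibre -/

/-- The integral along the fibres of `α e^{2print}`, where `t` is the vertical coordinate of the
trivialization of `P` given by the local section `s`: in the coordinates
`(y, t) ↦ e^{2prit} s(y)` write `α = dt ∧ β + γ`, where `β` and `γ` do not contain `dt`, and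
integrate `β e^{2print}` over `t ∈ [0, 1]`. -/
def fiberIntegralIn {pr : P → M} (s : LocalSection E E' pr) (n : ℤ) {k : ℕ}
    (α : Form E' P (k + 1)) : Form E M k :=
  fun x => ∫ t in (0 : ℝ)..1, Complex.exp (2 * Real.pi * Complex.I * n * t) •
    ((α (rot t (s.toFun x))).curryLeft
      (vert (rot t (s.toFun x)))).compContinuousLinearMap
        (tangentMapAt (fun y => rot t (s.toFun y)) x)

/-- The twisted integration along the fibre over the domain of the local section `s`. -/
def twistedIntegralIn {pr : P → M} (j : CircleBundleIso E E' L pr) (n : ℤ)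
    (s : LocalSection E E' pr) (α : TotalForm E' P) : LForm E L n :=
  fun k x => fiberIntegralIn s n (α (k + 1)) x ⊗ₜ[ℂ] tpow (j.frame s x) n

/-- The twisted integration along the fibre `∫^{P/M, n}`, computed at each point in a local
trivialization near that point. -/
def twistedIntegral {pr : P → M} (hpr : IsPrincipalCircleBundle E E' pr)
    (j : CircleBundleIso E E' L pr) (n : ℤ) (α : TotalForm E' P) : LForm E L n :=
  fun k x => twistedIntegralIn j n (hpr.localSection x) α k x

end Bundles

end ExoticForms

end

open ExoticForms

/-!
Over the domain of a local section `s`, the twisted fibre integral of `w` is `a ⊗ f^{⊗n}`, where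
`a = ∫₀¹ e^{2πint} β dt` and `w = dt ∧ β + γ` in the coordinates `(y, t) ↦ e^{2πit} s(y)`.

*Independence of the section.* Two sections differ at a point `x` by a rotation by an angle `τ`.
The component `β` at `x` can be computed with any lift of the tangent vectors of the base, because
`ι_{∂/∂t} w` is annihilated by `∂/∂t` and two lifts differ by multiples of `∂/∂t`
(`fiberVert_eq_of_lift`); hence, although `τ` varies with the point, the derivative of `τ` does not
enter. By periodicity `a` is multiplied by `e^{-2πinτ}` (`fiberIntegralIn_of_eq_rot`), which cancels
the factor `e^{2πinτ}` of `f^{⊗n}` (`twistedIntegralIn_eq`).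

*The exterior derivative.* The identity `ι_{∂/∂t} d(dt ∧ β + γ) = ∂γ/∂t - dβ` on the slices
(`vertPart_alternatizeUncurryFin`), differentiation under the integral sign and an integration by
parts in `t` give `da = -∫ e^{2πint} ι_{∂/∂t}(dw) dt - 2πin ∫ e^{2πint} γ dt`
(`extDeriv_integral_vertPart`, transported to the manifolds in `extDer_fiberIntegralIn`). The
boundary terms cancel since `γ` has period `1` in `t`.

*The connection.* By invariance, `Θ` restricts to the same form `s^*Θ` on all rotated sections, and
`Θ(∂/∂t) = 2πi`, so that the `dt`-component of `Θ ∧ w` is `2πi γ - s^*Θ ∧ β`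
(`fiberVert_oneWedge_succ`). Its first term cancels the contribution of the character to `da`, and
the outcome is `da + n s^*Θ ∧ a = -∫ e^{2πint} ι_{∂/∂t}(dw + nΘ ∧ w) dt` (`d_fiberCoeff_add`). As
the right-hand side is again a twisted fibre integral, the local expression of the covariant
derivative does not depend on `s` either (`covDerIn_twistedIntegral_eq_neg`).

*Contraction and multiplication.* The contraction with a lift of `Y` anticommutes with
`ι_{∂/∂t}` (`fiberVert_contract`), and so does the multiplication by the pullback of an odd form,
which is annihilated by `∂/∂t` (`fiberVert_wedge`). All these operations are linear over `ℂ` in each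
cotangent space, so they pass through the integral over `t` and through the tensor product with
`f^{⊗n}`.
-/

namespace ExoticForms

/-! ### Contraction of wedge products -/

section PermSums

/-- A permutation of `Fin (m + 1)` is a rotation `p.cycleRange` followed by a permutation which
fixes `0`. -/
theorem sum_perm_fin_succ {m : ℕ} {A : Type*} [AddCommMonoid A]
    (f : Equiv.Perm (Fin (m + 1)) → A) :
    ∑ σ, f σ = ∑ p : Fin (m + 1), ∑ τ : Equiv.Perm (Fin m),
      f (Equiv.Perm.decomposeFin.symm (0, τ) * p.cycleRange) := by
  refine Eq.trans ?_ (Fintype.sum_prod_type' (f := fun (p : Fin (m + 1)) τ =>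
    f (Equiv.Perm.decomposeFin.symm (0, τ) * p.cycleRange)))
  symm
  refine Fintype.sum_bijective (fun q : Fin (m + 1) × Equiv.Perm (Fin m) =>
    Equiv.Perm.decomposeFin.symm (0, q.2) * q.1.cycleRange) ?_ _ _ fun _ => rfl
  rw [Fintype.bijective_iff_injective_and_card]
  refine ⟨?_, by simp [Fintype.card_perm, Nat.factorial_succ]⟩
  rintro ⟨p, τ⟩ ⟨q, ρ⟩ h
  have hp (p : Fin (m + 1)) (τ : Equiv.Perm (Fin m)) :
      (Equiv.Perm.decomposeFin.symm (0, τ) * p.cycleRange) p = 0 := by simp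
  have hpq : p = q :=
    (Equiv.Perm.decomposeFin.symm (0, ρ) * q.cycleRange).injective
      (((DFunLike.congr_fun h p).symm.trans (hp p τ)).trans (hp q ρ).symm)
  subst hpq
  have := Equiv.Perm.decomposeFin.symm.injective (mul_right_cancel h)
  simp_all

theorem comp_decomposeFin_cycleRange {m : ℕ} {A : Type*} (a : A) (x : Fin m → A)
    (p : Fin (m + 1)) (τ : Equiv.Perm (Fin m)) (q : Fin (m + 1)) :
    (Fin.cons a x : Fin (m + 1) → A) ((Equiv.Perm.decomposeFin.symm (0, τ) * p.cycleRange) q) =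
      p.insertNth (α := fun _ => A) a (x ∘ τ) q := by
  rw [← Fin.cons_comp_cycleRange, Equiv.Perm.mul_apply, Function.comp_apply]
  generalize p.cycleRange q = r
  refine Fin.cases ?_ (fun r => ?_) r <;> simp

theorem sign_decomposeFin_mul_cycleRange {m : ℕ} (p : Fin (m + 1)) (τ : Equiv.Perm (Fin m)) :
    Equiv.Perm.sign (Equiv.Perm.decomposeFin.symm (0, τ) * p.cycleRange) =
      Equiv.Perm.sign τ * (-1) ^ (p : ℕ) := by
  rw [Equiv.Perm.sign_mul, Equiv.Perm.decomposeFin.symm_sign, Fin.sign_cycleRange]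
  simp

end PermSums

section Wedge

variable {E : Type*} [NormedAddCommGroup E] [NormedSpace ℝ E]
  {F : Type*} [NormedAddCommGroup F] [NormedSpace ℝ F] {i j k : ℕ}

/-- The wedge product as a sum over all permutations; each shuffle is counted `i! j!` times. -/
theorem factorial_smul_wedge_apply (h : i + j = k) (α : E [⋀^Fin i]→L[ℝ] ℂ)
    (β : E [⋀^Fin j]→L[ℝ] ℂ) (v : Fin k → E) :
    (i.factorial * j.factorial) • wedge h α β v = ∑ σ : Equiv.Perm (Fin k),
      Equiv.Perm.sign σ • (α (fun a => v (σ (Fin.cast h (Fin.castAdd j a)))) *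
        β (fun b => v (σ (Fin.cast h (Fin.natAdd i b))))) := by
  set e : Fin i ⊕ Fin j ≃ Fin k := finSumFinEquiv.trans (finCongr h) with he
  have h1 := congrArg (fun f => LinearMap.mul' ℝ ℂ (f fun a => v (e a)))
    (MultilinearMap.domCoprod_alternization_eq α.toAlternatingMap β.toAlternatingMap)
  simp only [Fintype.card_fin, MultilinearMap.alternatization_apply, map_sum] at h1
  rw [AlternatingMap.smul_apply, map_nsmul] at h1
  refine h1.symm.trans ?_
  refine Fintype.sum_equiv e.permCongr _ _ fun σ => ?_
  rw [Equiv.Perm.sign_permCongr]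
  simp only [Units.smul_def, map_zsmul]
  congr 1
  simp [MultilinearMap.domDomCongr_apply, MultilinearMap.domCoprod_apply, he]

/-- The wedge product commutes with linear pullback. -/
theorem wedge_compContinuousLinearMap (h : i + j = k) (α : F [⋀^Fin i]→L[ℝ] ℂ)
    (β : F [⋀^Fin j]→L[ℝ] ℂ) (f : E →L[ℝ] F) :
    (wedge h α β).compContinuousLinearMap f =
      wedge h (α.compContinuousLinearMap f) (β.compContinuousLinearMap f) := by
  ext v
  rw [ContinuousAlternatingMap.compContinuousLinearMap_apply, wedge_apply, wedge_apply]
  refine Finset.sum_congr rfl fun σ _ => ?_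
  induction σ using Quotient.inductionOn' with | _ σ
  simp only [mul'_summand]
  rfl

/-- If `u` annihilates the `i`-form `α`, then `ι_u (α ∧ β) = (-1)^i α ∧ ι_u β`. -/
theorem contract_wedge_of_forall_eq_zero (h : i + (j + 1) = k + 1) (h' : i + j = k)
    (α : E [⋀^Fin i]→L[ℝ] ℂ) (β : E [⋀^Fin (j + 1)]→L[ℝ] ℂ) (u : E)
    (hu : ∀ v : Fin i → E, (∃ a, v a = u) → α v = 0) :
    contract u (wedge h α β) = (-1 : ℂ) ^ i • wedge h' α (contract u β) := by
  subst h'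
  ext v
  have hfac : ((i.factorial * (j + 1).factorial : ℕ) : ℂ) ≠ 0 := by
    exact_mod_cast Nat.mul_ne_zero i.factorial_ne_zero (j + 1).factorial_ne_zero
  apply mul_left_cancel₀ hfac
  rw [← nsmul_eq_mul]
  change _ • wedge h α β (Fin.cons u v) = _ * ((-1 : ℂ) ^ i * wedge _ α (contract u β) v)
  rw [factorial_smul_wedge_apply, sum_perm_fin_succ]
  simp only [comp_decomposeFin_cycleRange, sign_decomposeFin_mul_cycleRange, Fin.cast_eq_self]
  refine (Fin.sum_univ_add (a := i) (b := j + 1) _).trans ?_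
  rw [Finset.sum_eq_zero, zero_add]
  · -- the `j + 1` slots of `β` into which `u` may be inserted contribute equally
    have hterm (b : Fin (j + 1)) :
        ∑ τ : Equiv.Perm (Fin (i + j)), (Equiv.Perm.sign τ * (-1) ^ (i + b : ℕ)) •
          (α (fun a => (Fin.natAdd i b).insertNth (α := fun _ => E) u (v ∘ τ)
              (Fin.castAdd (j + 1) a)) *
            β (fun c => (Fin.natAdd i b).insertNth (α := fun _ => E) u (v ∘ τ)
              (Fin.natAdd i c))) =
        (-1 : ℂ) ^ i * ((i.factorial * j.factorial) • wedge rfl α (contract u β) v) := by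
      rw [factorial_smul_wedge_apply, Finset.mul_sum]
      refine Finset.sum_congr rfl fun τ _ => ?_
      have h1 : (fun a => (Fin.natAdd i b).insertNth (α := fun _ => E) u (v ∘ τ)
          (Fin.castAdd (j + 1) a)) = fun a => v (τ (Fin.castAdd j a)) := by
        funext a
        have : Fin.castAdd (j + 1) a = (Fin.natAdd i b).succAbove (Fin.castAdd j a) := by
          rw [Fin.succAbove_of_castSucc_lt]
          · rfl
          · simp [Fin.lt_def]; omega
        rw [this]
        exact Fin.insertNth_apply_succAbove (α := fun _ => E) _ _ _ _
      have h2 : (fun c => (Fin.natAdd i b).insertNth (α := fun _ => E) u (v ∘ τ)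
          (Fin.natAdd i c)) =
            b.insertNth (α := fun _ => E) u fun d => v (τ (Fin.natAdd i d)) := by
        rw [Fin.eq_insertNth_iff]
        refine ⟨Fin.insertNth_apply_same (α := fun _ => E) _ _ _, ?_⟩
        funext d
        have : Fin.natAdd i (b.succAbove d) = (Fin.natAdd i b).succAbove (Fin.natAdd i d) := by
          simp only [Fin.succAbove, Fin.lt_def, Fin.ext_iff]
          split_ifs <;> simp_all <;> omega
        rw [Fin.removeNth, this]
        exact Fin.insertNth_apply_succAbove (α := fun _ => E) _ _ _ _
      rw [h1, h2, ContinuousAlternatingMap.map_insertNth]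
      simp only [Units.smul_def, zsmul_eq_mul, Fin.cast_eq_self]
      change _ = _ * (_ * (α _ * β (Matrix.vecCons u _)))
      have hb : ((-1 : ℂ) ^ (b : ℕ)) * (-1) ^ (b : ℕ) = 1 := by
        rw [← mul_pow]; simp
      push_cast
      rw [pow_add]
      linear_combination (((Equiv.Perm.sign τ : ℤ) : ℂ) * (-1) ^ i *
        α (fun a => v (τ (Fin.castAdd j a))) *
        β (Matrix.vecCons u fun d => v (τ (Fin.natAdd i d)))) * hb
    refine (Finset.sum_congr rfl fun b _ => hterm b).trans ?_
    rw [Finset.sum_const, Finset.card_univ, Fintype.card_fin, Nat.factorial_succ]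
    simp only [nsmul_eq_mul]
    push_cast
    ring
  · refine fun a _ => Finset.sum_eq_zero fun τ _ => ?_
    rw [hu _ ⟨a, Fin.insertNth_apply_same (α := fun _ => E) _ _ _⟩, zero_mul, smul_zero]

/-- The wedge product of a `1`-form and a `k`-form, as a sum over the slot of the `1`-form. -/
theorem one_wedge_apply (h : 1 + k = k + 1) (θ : E [⋀^Fin 1]→L[ℝ] ℂ) (α : E [⋀^Fin k]→L[ℝ] ℂ)
    (v : Fin (k + 1) → E) :
    wedge h θ α v = ∑ p : Fin (k + 1), (-1 : ℂ) ^ (p : ℕ) * (θ (fun _ => v p) *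
      α (p.removeNth v)) := by
  have hfac : ((Nat.factorial 1 * k.factorial : ℕ) : ℂ) ≠ 0 := by
    exact_mod_cast Nat.mul_ne_zero (Nat.factorial_ne_zero 1) k.factorial_ne_zero
  apply mul_left_cancel₀ hfac
  rw [← nsmul_eq_mul, factorial_smul_wedge_apply, ← Equiv.sum_comp (Equiv.inv _),
    sum_perm_fin_succ, Finset.mul_sum]
  refine Finset.sum_congr rfl fun p _ => ?_
  have hterm (τ : Equiv.Perm (Fin k)) :
      (Equiv.Perm.sign ((Equiv.inv (Equiv.Perm (Fin (k + 1))))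
        (Equiv.Perm.decomposeFin.symm (0, τ) * p.cycleRange))) •
      (θ (fun a => v ((Equiv.inv (Equiv.Perm (Fin (k + 1))))
        (Equiv.Perm.decomposeFin.symm (0, τ) * p.cycleRange) (Fin.cast h (Fin.castAdd k a)))) *
       α (fun b => v ((Equiv.inv (Equiv.Perm (Fin (k + 1))))
        (Equiv.Perm.decomposeFin.symm (0, τ) * p.cycleRange) (Fin.cast h (Fin.natAdd 1 b))))) =
      (-1 : ℂ) ^ (p : ℕ) * (θ (fun _ => v p) * α (p.removeNth v)) := by
    have h0 (a : Fin 1) : Fin.cast h (Fin.castAdd k a) = 0 := by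
      ext; simp
    have h1 (b : Fin k) : Fin.cast h (Fin.natAdd 1 b) = b.succ := by
      ext; simp
    have hz : ((Equiv.inv (Equiv.Perm (Fin (k + 1))))
        (Equiv.Perm.decomposeFin.symm (0, τ) * p.cycleRange)) 0 = p := by
      rw [Equiv.inv_apply, Equiv.Perm.inv_eq_iff_eq]
      simp
    have hs (b : Fin k) : ((Equiv.inv (Equiv.Perm (Fin (k + 1))))
        (Equiv.Perm.decomposeFin.symm (0, τ) * p.cycleRange)) b.succ =
          p.succAbove (τ⁻¹ b) := by
      rw [Equiv.inv_apply, Equiv.Perm.inv_eq_iff_eq]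
      simp
    simp only [h0, h1, hz, hs]
    rw [Equiv.inv_apply, Equiv.Perm.sign_inv, sign_decomposeFin_mul_cycleRange]
    have h2 : α (fun b => v (p.succAbove (τ⁻¹ b))) =
        Equiv.Perm.sign τ • α (p.removeNth v) := by
      rw [← Equiv.Perm.sign_inv]
      exact α.map_perm (p.removeNth v) τ⁻¹
    rw [h2]
    simp only [Units.smul_def, zsmul_eq_mul]
    have hb : (((Equiv.Perm.sign τ : ℤ) : ℂ)) * ((Equiv.Perm.sign τ : ℤ) : ℂ) = 1 := by
      rw [← Int.cast_mul, ← Units.val_mul, Int.units_mul_self]; simp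
    push_cast
    linear_combination ((-1) ^ (p : ℕ) * θ (fun _ => v p) * α (p.removeNth v)) * hb
  rw [Finset.sum_congr rfl fun τ _ => hterm τ]
  simp [Fintype.card_perm]

/-- `ι_u (θ ∧ α) = θ(u) α - θ ∧ ι_u α` for a `1`-form `θ`. -/
theorem contract_one_wedge (h : 1 + (k + 1) = k + 1 + 1) (h' : 1 + k = k + 1)
    (θ : E [⋀^Fin 1]→L[ℝ] ℂ) (α : E [⋀^Fin (k + 1)]→L[ℝ] ℂ) (u : E) :
    contract u (wedge h θ α) = θ (fun _ => u) • α - wedge h' θ (contract u α) := by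
  ext v
  change wedge h θ α (Fin.cons u v) = θ (fun _ => u) * α v - wedge h' θ (contract u α) v
  rw [one_wedge_apply, one_wedge_apply, Fin.sum_univ_succ, sub_eq_add_neg, ← Finset.sum_neg_distrib]
  congr 1
  · simp
  · refine Finset.sum_congr rfl fun p _ => ?_
    have : (p.succ.removeNth (Fin.cons u v : Fin (k + 1 + 1) → E)) =
        Fin.cons u (p.removeNth v) := by
      funext q
      refine Fin.cases ?_ (fun q => ?_) q <;> simp [Fin.removeNth]
    rw [this]
    change _ = -((-1) ^ (p : ℕ) * (θ (fun _ => v p) * α (Fin.cons u (p.removeNth v))))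
    simp [pow_succ]

/-- `ι_u (θ ∧ α) = θ(u) α` for a `1`-form `θ` and a function `α`. -/
theorem contract_one_wedge_zero (h : 1 + 0 = 0 + 1)
    (θ : E [⋀^Fin 1]→L[ℝ] ℂ) (α : E [⋀^Fin 0]→L[ℝ] ℂ) (u : E) :
    contract u (wedge h θ α) = θ (fun _ => u) • α := by
  ext v
  change wedge h θ α (Fin.cons u v) = θ (fun _ => u) * α v
  rw [one_wedge_apply, Fin.sum_univ_one]
  simp [Subsingleton.elim _ v]

/-- If `u` annihilates the `i`-form `α`, then it annihilates the product of `α` with a function. -/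
theorem contract_wedge_zero_of_forall_eq_zero (h : i + 0 = k + 1)
    (α : E [⋀^Fin i]→L[ℝ] ℂ) (β : E [⋀^Fin 0]→L[ℝ] ℂ) (u : E)
    (hu : ∀ v : Fin i → E, (∃ a, v a = u) → α v = 0) :
    contract u (wedge h α β) = 0 := by
  obtain rfl : i = k + 1 := by omega
  ext v
  change wedge h α β (Fin.cons u v) = 0
  have hfac : (((k + 1).factorial * Nat.factorial 0 : ℕ) : ℂ) ≠ 0 := by
    exact_mod_cast Nat.mul_ne_zero (k + 1).factorial_ne_zero (Nat.factorial_ne_zero 0)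
  apply mul_left_cancel₀ hfac
  rw [← nsmul_eq_mul, factorial_smul_wedge_apply, mul_zero]
  refine Finset.sum_eq_zero fun σ _ => ?_
  rw [hu _ ⟨σ⁻¹ 0, by simp⟩, zero_mul, smul_zero]

end Wedge

/-! ### Forms on a cylinder and Stokes' theorem in the periodic variable -/

section FiniteDimension

variable {V : Type*} [NormedAddCommGroup V] [NormedSpace ℝ V] [FiniteDimensional ℝ V]
  {W : Type*} [NormedAddCommGroup W] [NormedSpace ℝ W] [FiniteDimensional ℝ W]
  {X : Type*} [NormedAddCommGroup X] [NormedSpace ℝ X]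

instance finiteDimensional_continuousMultilinearMap (k : ℕ) :
    FiniteDimensional ℝ (ContinuousMultilinearMap ℝ (fun _ : Fin k => V) ℂ) :=
  FiniteDimensional.of_injective
    (ContinuousMultilinearMap.toMultilinearMapLinear (R' := ℝ) (A := ℝ)
      (M₁ := fun _ : Fin k => V) (M₂ := ℂ))
    ContinuousMultilinearMap.toMultilinearMap_injective

instance finiteDimensional_continuousAlternatingMap (k : ℕ) :
    FiniteDimensional ℝ (V [⋀^Fin k]→L[ℝ] ℂ) :=
  FiniteDimensional.of_injective
    (ContinuousAlternatingMap.toContinuousMultilinearMapLinear (R := ℝ) (A := ℝ) (ι := Fin k)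
      (M := V) (N := ℂ))
    ContinuousAlternatingMap.toContinuousMultilinearMap_injective

omit [FiniteDimensional ℝ W] in
/-- The pullback `(α, g) ↦ g^* α` of alternating forms under linear maps is smooth. -/
theorem contDiffOn_compContinuousLinearMap {k : ℕ} {r : WithTop ℕ∞} {s : Set X}
    {α : X → W [⋀^Fin k]→L[ℝ] ℂ} {g : X → V →L[ℝ] W} (hα : ContDiffOn ℝ r α s)
    (hg : ContDiffOn ℝ r g s) :
    ContDiffOn ℝ r (fun x => (α x).compContinuousLinearMap (g x)) s := by
  -- the inclusion of alternating maps into multilinear maps has a linear retraction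
  obtain ⟨ρ, hρ⟩ := LinearMap.exists_leftInverse_of_injective
    (ContinuousAlternatingMap.toContinuousMultilinearMapLinear (R := ℝ) (A := ℝ) (ι := Fin k)
      (M := V) (N := ℂ))
    (LinearMap.ker_eq_bot.2 ContinuousAlternatingMap.toContinuousMultilinearMap_injective)
  have h1 : ContDiffOn ℝ r (fun x =>
      ContinuousMultilinearMap.compContinuousLinearMapContinuousMultilinear ℝ
        (fun _ : Fin k => V) (fun _ : Fin k => W) ℂ (fun _ => g x)
        (ContinuousAlternatingMap.toContinuousMultilinearMapCLM ℝ (α x))) s := by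
    refine ContDiffOn.clm_apply ?_ ?_
    · exact (ContinuousMultilinearMap.contDiff _).comp_contDiffOn (contDiffOn_pi.2 fun _ => hg)
    · exact (ContinuousLinearMap.contDiff _).comp_contDiffOn hα
  have h2 := (LinearMap.toContinuousLinearMap ρ).contDiff.comp_contDiffOn (n := r) h1
  refine h2.congr fun x _ => ?_
  exact (LinearMap.congr_fun hρ ((α x).compContinuousLinearMap (g x))).symm

end FiniteDimension

section ParametricIntegral

variable {V : Type*} [NormedAddCommGroup V] [NormedSpace ℝ V] [FiniteDimensional ℝ V]
  {W : Type*} [NormedAddCommGroup W] [NormedSpace ℝ W]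

omit [NormedSpace ℝ V] [FiniteDimensional ℝ V] in
theorem continuous_slice {O : Set V} {z : V} {A : Type*} [TopologicalSpace A] {g : V × ℝ → A}
    (hg : ContinuousOn g (O ×ˢ Set.univ)) (hz : z ∈ O) : Continuous fun t : ℝ => g (z, t) := by
  rw [← continuousOn_univ]
  exact hg.comp (by fun_prop) fun t _ => ⟨hz, trivial⟩

/-- Differentiation under the integral sign over a compact interval. -/
theorem hasFDerivAt_intervalIntegral_prod {f : V × ℝ → W} {O : Set V} (hO : IsOpen O)
    (hf : ContDiffOn ℝ 1 f (O ×ˢ Set.univ)) {z : V} (hz : z ∈ O) :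
    HasFDerivAt (fun y => ∫ t in (0 : ℝ)..1, f (y, t))
      (∫ t in (0 : ℝ)..1, (fderiv ℝ f (z, t)).comp (ContinuousLinearMap.inl ℝ V ℝ)) z := by
  have hopen : IsOpen (O ×ˢ (Set.univ : Set ℝ)) := hO.prod isOpen_univ
  have hf' : ContinuousOn (fderiv ℝ f) (O ×ˢ Set.univ) :=
    hf.continuousOn_fderiv_of_isOpen hopen le_rfl
  have hF' : ContinuousOn (fun q => (fderiv ℝ f q).comp (ContinuousLinearMap.inl ℝ V ℝ))
      (O ×ˢ Set.univ) := hf'.clm_comp continuousOn_const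
  obtain ⟨ε, hε, hball⟩ := Metric.nhds_basis_closedBall.mem_iff.1 (hO.mem_nhds hz)
  have hK : IsCompact (Metric.closedBall z ε ×ˢ Set.Icc (0 : ℝ) 1) :=
    (isCompact_closedBall z ε).prod isCompact_Icc
  obtain ⟨C, hC⟩ := hK.exists_bound_of_continuousOn
    (hF'.mono (Set.prod_mono hball (Set.subset_univ _)))
  refine intervalIntegral.hasFDerivAt_integral_of_dominated_of_fderiv_le
    (s := Metric.closedBall z ε) (bound := fun _ => C)
    (F' := fun y t => (fderiv ℝ f (y, t)).comp (ContinuousLinearMap.inl ℝ V ℝ))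
    (Metric.closedBall_mem_nhds z hε) ?_ ?_ ?_ ?_ ?_ ?_
  · filter_upwards [hO.mem_nhds hz] with y hy
    exact (continuous_slice hf.continuousOn hy).aestronglyMeasurable
  · exact (continuous_slice hf.continuousOn hz).intervalIntegrable _ _
  · exact (continuous_slice hF' hz).aestronglyMeasurable
  · refine Filter.Eventually.of_forall fun t ht y hy => hC (y, t) ⟨hy, ?_⟩
    rw [Set.uIoc_of_le zero_le_one] at ht
    exact Set.Ioc_subset_Icc_self ht
  · exact intervalIntegrable_const
  · refine Filter.Eventually.of_forall fun t _ y hy => ?_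
    have h1 : HasFDerivAt f (fderiv ℝ f (y, t)) (y, t) :=
      ((hf.contDiffAt (hopen.mem_nhds ⟨hball hy, trivial⟩)).differentiableAt
        one_ne_zero).hasFDerivAt
    exact h1.comp y (hasFDerivAt_prodMk_left y t)

/-- Linear differential operators of first order commute with integration over a compact
interval. -/
theorem map_fderiv_intervalIntegral_prod [CompleteSpace W] {Z : Type*} [NormedAddCommGroup Z]
    [NormedSpace ℝ Z] [CompleteSpace Z] (B : (V →L[ℝ] W) →L[ℝ] Z) {f : V × ℝ → W} {O : Set V}
    (hO : IsOpen O) (hf : ContDiffOn ℝ 1 f (O ×ˢ Set.univ)) {z : V} (hz : z ∈ O) :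
    B (fderiv ℝ (fun y => ∫ t in (0 : ℝ)..1, f (y, t)) z) =
      ∫ t in (0 : ℝ)..1, B ((fderiv ℝ f (z, t)).comp (ContinuousLinearMap.inl ℝ V ℝ)) := by
  have hD : Continuous fun t : ℝ => (fderiv ℝ f (z, t)).comp (ContinuousLinearMap.inl ℝ V ℝ) :=
    (continuous_slice (hf.continuousOn_fderiv_of_isOpen (hO.prod isOpen_univ) le_rfl)
      hz).clm_comp continuous_const
  rw [(hasFDerivAt_intervalIntegral_prod hO hf hz).fderiv,
    ContinuousLinearMap.intervalIntegral_comp_comm _ (hD.intervalIntegrable _ _)]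

/-- Integrals over a compact interval depend smoothly on parameters. -/
theorem contDiffOn_intervalIntegral_prod {f : V × ℝ → W} {O : Set V} (hO : IsOpen O)
    (hf : ContDiffOn ℝ ∞ f (O ×ˢ Set.univ)) :
    ContDiffOn ℝ ∞ (fun y => ∫ t in (0 : ℝ)..1, f (y, t)) O := by
  rw [contDiffOn_infty]
  intro n
  have hopen : IsOpen (O ×ˢ (Set.univ : Set ℝ)) := hO.prod isOpen_univ
  induction n generalizing f with
  | zero =>
    rw [Nat.cast_zero, contDiffOn_zero]
    intro z hz
    exact (hasFDerivAt_intervalIntegral_prod hO (hf.of_le (by simp)) hz).continuousAt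
      |>.continuousWithinAt
  | succ n ih =>
    rw [Nat.cast_succ, contDiffOn_succ_iff_fderiv_apply hO.uniqueDiffOn]
    refine ⟨fun z hz => (hasFDerivAt_intervalIntegral_prod hO
      (hf.of_le (by simp)) hz).differentiableAt.differentiableWithinAt, by simp, fun v => ?_⟩
    have hfv : ContDiffOn ℝ ∞ (fun q => fderiv ℝ f q (v, 0)) (O ×ˢ Set.univ) :=
      (hf.fderiv_of_isOpen hopen (m := ∞) (by simp)).clm_apply contDiffOn_const
    refine (ih hfv).congr fun z hz => ?_
    rw [fderivWithin_of_isOpen hO hz,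
      (hasFDerivAt_intervalIntegral_prod hO (hf.of_le (by simp)) hz).fderiv,
      ContinuousLinearMap.intervalIntegral_apply]
    · rfl
    · refine Continuous.intervalIntegrable ?_ _ _
      rw [← continuousOn_univ]
      refine ContinuousOn.clm_comp ?_ continuousOn_const
      exact (hf.continuousOn_fderiv_of_isOpen hopen (by simp)).comp (by fun_prop)
        fun t _ => ⟨hz, trivial⟩

end ParametricIntegral

section Cylinder

variable {V : Type*} [NormedAddCommGroup V] [NormedSpace ℝ V] {k : ℕ}

variable (V) in
/-- For a form `dt ∧ β + γ` on `V × ℝ`, where `β` and `γ` do not contain `dt`, the component `γ`,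
that is, the restriction of the form to the slices `V × {t}`. -/
noncomputable def horizPart (k : ℕ) : ((V × ℝ) [⋀^Fin k]→L[ℝ] ℂ) →L[ℝ] (V [⋀^Fin k]→L[ℝ] ℂ) :=
  ContinuousAlternatingMap.compContinuousLinearMapCLM (ContinuousLinearMap.inl ℝ V ℝ)

variable (V) in
/-- For a form `dt ∧ β + γ` on `V × ℝ`, where `β` and `γ` do not contain `dt`, the component `β`,
that is, the restriction to the slices `V × {t}` of the contraction with `∂/∂t`. -/
noncomputable def vertPart (k : ℕ) : ((V × ℝ) [⋀^Fin (k + 1)]→L[ℝ] ℂ) →L[ℝ] (V [⋀^Fin k]→L[ℝ] ℂ) :=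
  (horizPart V k).comp ((ContinuousLinearMap.apply ℝ _ ((0, 1) : V × ℝ)).comp
    (ContinuousAlternatingMap.curryLeftLI (𝕜 := ℝ) (E := V × ℝ) (F := ℂ)
      (n := k)).toContinuousLinearMap)

theorem horizPart_apply (α : (V × ℝ) [⋀^Fin k]→L[ℝ] ℂ) (v : Fin k → V) :
    horizPart V k α v = α fun a => (v a, 0) := rfl

theorem vertPart_apply (α : (V × ℝ) [⋀^Fin (k + 1)]→L[ℝ] ℂ) (v : Fin k → V) :
    vertPart V k α v = α (Fin.cons (0, 1) fun a => (v a, 0)) := rfl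

open ContinuousAlternatingMap in
/-- The algebraic content of `ι_{∂/∂t} d(dt ∧ β + γ) = ∂γ/∂t - d_V β`. -/
theorem vertPart_alternatizeUncurryFin
    (A : V × ℝ →L[ℝ] (V × ℝ) [⋀^Fin (k + 1)]→L[ℝ] ℂ) :
    vertPart V (k + 1) (alternatizeUncurryFin A) = horizPart V (k + 1) (A (0, 1)) -
      alternatizeUncurryFin (((vertPart V k).comp A).comp (ContinuousLinearMap.inl ℝ V ℝ)) := by
  ext v
  rw [vertPart_apply, ContinuousAlternatingMap.sub_apply, alternatizeUncurryFin_apply,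
    alternatizeUncurryFin_apply, Fin.sum_univ_succ, sub_eq_add_neg, ← Finset.sum_neg_distrib]
  congr 1
  · simp [horizPart_apply]
  · refine Finset.sum_congr rfl fun p _ => ?_
    have : (p.succ.removeNth (Fin.cons (0, 1) fun a => (v a, 0) : Fin (k + 1 + 1) → V × ℝ)) =
        Fin.cons (0, 1) fun a => (p.removeNth v a, 0) := by
      funext q
      refine Fin.cases ?_ (fun q => ?_) q <;> simp [Fin.removeNth]
    rw [this]
    simp [pow_succ, vertPart_apply]

open ContinuousAlternatingMap in
theorem vertPart_alternatizeUncurryFin_zero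
    (A : V × ℝ →L[ℝ] (V × ℝ) [⋀^Fin 0]→L[ℝ] ℂ) :
    vertPart V 0 (alternatizeUncurryFin A) = horizPart V 0 (A (0, 1)) := by
  ext v
  rw [vertPart_apply, alternatizeUncurryFin_apply, Fin.sum_univ_one]
  simp [horizPart_apply]

/-- The character `t ↦ e^{2πint}` of the circle of length `1`. -/
noncomputable def character (n : ℤ) (t : ℝ) : ℂ := Complex.exp (2 * Real.pi * Complex.I * n * t)

theorem character_zero (n : ℤ) : character n 0 = 1 := by simp [character]

theorem character_add (n : ℤ) (s t : ℝ) : character n (s + t) = character n s * character n t := by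
  rw [character, character, character, ← Complex.exp_add]
  push_cast
  ring_nf

theorem character_one (n : ℤ) : character n 1 = 1 := by
  rw [character, Complex.exp_eq_one_iff]
  exact ⟨n, by push_cast; ring⟩

theorem contDiff_character (n : ℤ) {r : WithTop ℕ∞} : ContDiff ℝ r (character n) :=
  Complex.contDiff_exp.comp (contDiff_const.mul Complex.ofRealCLM.contDiff)

theorem hasDerivAt_character (n : ℤ) (t : ℝ) :
    HasDerivAt (character n) (2 * Real.pi * Complex.I * n * character n t) t := by
  have h1 : HasDerivAt (fun t : ℝ => 2 * Real.pi * Complex.I * n * (t : ℂ))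
      (2 * Real.pi * Complex.I * n) t := by
    simpa using (HasDerivAt.ofReal_comp (hasDerivAt_id t)).const_mul (2 * Real.pi * Complex.I * n)
  rw [mul_comm]
  exact h1.cexp

end Cylinder

section Stokes

variable {V : Type*} [NormedAddCommGroup V] [NormedSpace ℝ V] [FiniteDimensional ℝ V] {k : ℕ}
  {O : Set V} {z : V}

/-- The twisted integral of the `dt`-component of a smooth form is smooth. -/
theorem contDiffOn_integral_vertPart (n : ℤ) (hO : IsOpen O)
    {w : V × ℝ → (V × ℝ) [⋀^Fin (k + 1)]→L[ℝ] ℂ} (hw : ContDiffOn ℝ ∞ w (O ×ˢ Set.univ)) :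
    ContDiffOn ℝ ∞ (fun y => ∫ t in (0 : ℝ)..1, character n t • vertPart V k (w (y, t))) O := by
  refine contDiffOn_intervalIntegral_prod (f := fun q => character n q.2 • vertPart V k (w q)) hO ?_
  exact ((contDiff_character n).comp contDiff_snd).contDiffOn.smul
    ((vertPart V k).contDiff.comp_contDiffOn hw)

omit [FiniteDimensional ℝ V] in
/-- Integration by parts in the variable `t`; the boundary terms cancel since `γ` takes the same
value at `t = 0` and `t = 1`. -/
theorem integral_character_smul_deriv (n : ℤ) (hO : IsOpen O)
    {w : V × ℝ → (V × ℝ) [⋀^Fin k]→L[ℝ] ℂ} (hw : ContDiffOn ℝ ∞ w (O ×ˢ Set.univ)) (hz : z ∈ O)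
    (hper : horizPart V k (w (z, 1)) = horizPart V k (w (z, 0))) :
    ∫ t in (0 : ℝ)..1, character n t • horizPart V k (fderiv ℝ w (z, t) (0, 1)) =
      -((2 * Real.pi * Complex.I * n) •
        ∫ t in (0 : ℝ)..1, character n t • horizPart V k (w (z, t))) := by
  have hopen : IsOpen (O ×ˢ (Set.univ : Set ℝ)) := hO.prod isOpen_univ
  have hc : Continuous (character n) := (contDiff_character n (r := 0)).continuous
  have hw0 := continuous_slice hw.continuousOn hz
  have hw1 := continuous_slice (hw.continuousOn_fderiv_of_isOpen hopen (by simp)) hz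
  have hi1 : Continuous fun t => character n t • horizPart V k (fderiv ℝ w (z, t) (0, 1)) :=
    hc.smul ((horizPart V k).continuous.comp (hw1.clm_apply continuous_const))
  have hi2 : Continuous fun t => (2 * Real.pi * Complex.I * n * character n t) •
      horizPart V k (w (z, t)) :=
    (continuous_const.mul hc).smul ((horizPart V k).continuous.comp hw0)
  have hderiv (t : ℝ) : HasDerivAt (fun t => character n t • horizPart V k (w (z, t)))
      (character n t • horizPart V k (fderiv ℝ w (z, t) (0, 1)) +
        (2 * Real.pi * Complex.I * n * character n t) • horizPart V k (w (z, t))) t := by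
    have h1 : HasFDerivAt w (fderiv ℝ w (z, t)) (z, t) :=
      ((hw.contDiffAt (hopen.mem_nhds ⟨hz, trivial⟩)).differentiableAt (by simp)).hasFDerivAt
    have h2 : HasDerivAt (fun t : ℝ => (z, t)) ((0, 1) : V × ℝ) t :=
      (hasDerivAt_const t z).prodMk (hasDerivAt_id t)
    have h3 := (horizPart V k).hasFDerivAt.comp_hasDerivAt t (h1.comp_hasDerivAt t h2)
    exact (hasDerivAt_character n t).smul h3
  have hftc := intervalIntegral.integral_eq_sub_of_hasDerivAt (a := 0) (b := 1)
    (fun t _ => hderiv t) ((hi1.add hi2).intervalIntegrable _ _)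
  rw [intervalIntegral.integral_add (hi1.intervalIntegrable _ _) (hi2.intervalIntegrable _ _),
    character_one, character_zero, hper, sub_self] at hftc
  rw [eq_neg_of_add_eq_zero_left hftc, ← intervalIntegral.integral_smul]
  simp only [mul_smul]

/-- Twisted integration over the circle anticommutes with the exterior derivative, up to the term
which comes from the derivative of the character. -/
theorem extDeriv_integral_vertPart (n : ℤ) (hO : IsOpen O)
    {w : V × ℝ → (V × ℝ) [⋀^Fin (k + 1)]→L[ℝ] ℂ} (hw : ContDiffOn ℝ ∞ w (O ×ˢ Set.univ))
    (hz : z ∈ O) (hper : horizPart V (k + 1) (w (z, 1)) = horizPart V (k + 1) (w (z, 0))) :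
    extDeriv (fun y => ∫ t in (0 : ℝ)..1, character n t • vertPart V k (w (y, t))) z =
      -(∫ t in (0 : ℝ)..1, character n t • vertPart V (k + 1) (extDeriv w (z, t))) -
        (2 * Real.pi * Complex.I * n) •
          ∫ t in (0 : ℝ)..1, character n t • horizPart V (k + 1) (w (z, t)) := by
  have hopen : IsOpen (O ×ˢ (Set.univ : Set ℝ)) := hO.prod isOpen_univ
  have hc : Continuous (character n) := (contDiff_character n (r := 0)).continuous
  have hw1 := continuous_slice (hw.continuousOn_fderiv_of_isOpen hopen (by simp)) hz
  have hi1 : Continuous fun t => character n t • horizPart V (k + 1) (fderiv ℝ w (z, t) (0, 1)) :=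
    hc.smul ((horizPart V (k + 1)).continuous.comp (hw1.clm_apply continuous_const))
  have hi2 : Continuous fun t => character n t • vertPart V (k + 1) (extDeriv w (z, t)) :=
    hc.smul ((vertPart V (k + 1)).continuous.comp
      ((ContinuousAlternatingMap.alternatizeUncurryFinCLM ℝ (V × ℝ) ℂ).continuous.comp hw1))
  have hsm : ContDiffOn ℝ 1 (fun q : V × ℝ => character n q.2 • vertPart V k (w q))
      (O ×ˢ Set.univ) :=
    ((contDiff_character n).comp contDiff_snd).contDiffOn.smul
      ((vertPart V k).contDiff.comp_contDiffOn (hw.of_le (by simp)))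
  have hcomm := map_fderiv_intervalIntegral_prod
    (ContinuousAlternatingMap.alternatizeUncurryFinCLM ℝ V ℂ (n := k)) hO hsm hz
  rw [extDeriv, ← ContinuousAlternatingMap.alternatizeUncurryFinCLM_apply (𝕜 := ℝ)]
  refine hcomm.trans ?_
  rw [sub_eq_add_neg, ← integral_character_smul_deriv n hO hw hz hper, neg_add_eq_sub,
    ← intervalIntegral.integral_sub (hi1.intervalIntegrable _ _) (hi2.intervalIntegrable _ _)]
  refine intervalIntegral.integral_congr fun t _ => ?_
  have h1 : HasFDerivAt w (fderiv ℝ w (z, t)) (z, t) :=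
    ((hw.contDiffAt (hopen.mem_nhds ⟨hz, trivial⟩)).differentiableAt (by simp)).hasFDerivAt
  have h2 : (fderiv ℝ (fun q : V × ℝ => character n q.2 • vertPart V k (w q)) (z, t)).comp
      (ContinuousLinearMap.inl ℝ V ℝ) = character n t •
        (((vertPart V k).comp (fderiv ℝ w (z, t))).comp (ContinuousLinearMap.inl ℝ V ℝ)) := by
    have hd : DifferentiableAt ℝ (fun q : V × ℝ => character n q.2 • vertPart V k (w q)) (z, t) :=
      (hsm.contDiffAt (hopen.mem_nhds ⟨hz, trivial⟩)).differentiableAt one_ne_zero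
    have h3 := hd.hasFDerivAt.comp (f := fun y => (y, t)) z (hasFDerivAt_prodMk_left z t)
    have h4 : HasFDerivAt (fun q => vertPart V k (w q))
        ((vertPart V k).comp (fderiv ℝ w (z, t))) (z, t) :=
      (vertPart V k).hasFDerivAt.comp (z, t) h1
    exact h3.unique ((h4.comp (f := fun y => (y, t)) z
      (hasFDerivAt_prodMk_left z t)).const_smul (character n t))
  simp only [h2, ContinuousAlternatingMap.alternatizeUncurryFinCLM_apply, extDeriv,
    vertPart_alternatizeUncurryFin, smul_sub, sub_sub_cancel]
  exact ContinuousAlternatingMap.alternatizeUncurryFin_smul _ _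

omit [FiniteDimensional ℝ V] in
/-- Stokes' theorem on the circle, for the twisted integral of the derivative of a function. -/
theorem integral_vertPart_extDeriv_zero (n : ℤ) (hO : IsOpen O)
    {w : V × ℝ → (V × ℝ) [⋀^Fin 0]→L[ℝ] ℂ} (hw : ContDiffOn ℝ ∞ w (O ×ˢ Set.univ))
    (hz : z ∈ O) (hper : horizPart V 0 (w (z, 1)) = horizPart V 0 (w (z, 0))) :
    ∫ t in (0 : ℝ)..1, character n t • vertPart V 0 (extDeriv w (z, t)) =
      -((2 * Real.pi * Complex.I * n) •
        ∫ t in (0 : ℝ)..1, character n t • horizPart V 0 (w (z, t))) := by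
  rw [← integral_character_smul_deriv n hO hw hz hper]
  simp only [extDeriv, vertPart_alternatizeUncurryFin_zero]

end Stokes

/-! ### Pullbacks of forms to open subsets of vector spaces -/

section Pullback

variable {E : Type*} [NormedAddCommGroup E] [NormedSpace ℝ E]
  {M : Type*} [TopologicalSpace M] [ChartedSpace E M]
  {E' : Type*} [NormedAddCommGroup E'] [NormedSpace ℝ E']
  {P : Type*} [TopologicalSpace P] [ChartedSpace E' P]
  {E'' : Type*} [NormedAddCommGroup E''] [NormedSpace ℝ E'']
  {Q : Type*} [TopologicalSpace Q] [ChartedSpace E'' Q] {k : ℕ}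

theorem tangentMapAt_comp {f : M → P} {g : P → Q} {x : M}
    (hg : MDifferentiableAt 𝓘(ℝ, E') 𝓘(ℝ, E'') g (f x))
    (hf : MDifferentiableAt 𝓘(ℝ, E) 𝓘(ℝ, E') f x) :
    tangentMapAt (E := E) (E' := E'') (fun y => g (f y)) x =
      (tangentMapAt (E := E') (E' := E'') g (f x)).comp (tangentMapAt f x) :=
  mfderiv_comp x hg hf

theorem tangentMapAt_congr {f g : M → P} {x : M} (h : f =ᶠ[𝓝 x] g) :
    tangentMapAt (E := E) (E' := E') f x = tangentMapAt (E := E) (E' := E') g x :=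
  h.mfderiv_eq

theorem pullback_comp {f : M → P} {g : P → Q} {x : M} (α : Form E'' Q k)
    (hg : MDifferentiableAt 𝓘(ℝ, E') 𝓘(ℝ, E'') g (f x))
    (hf : MDifferentiableAt 𝓘(ℝ, E) 𝓘(ℝ, E') f x) :
    pullback (E := E) (fun y => g (f y)) α x =
      (pullback (E := E') g α (f x)).compContinuousLinearMap (tangentMapAt f x) := by
  ext v
  simp only [pullback, tangentMapAt_comp hg hf]
  rfl

theorem pullback_congr {f g : M → P} {x : M} (α : Form E' P k) (h : f =ᶠ[𝓝 x] g) :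
    pullback (E := E) f α x = pullback (E := E) g α x := by
  simp only [pullback, tangentMapAt_congr h, h.eq_of_nhds]

theorem extDer_congr {α β : Form E M k} {x : M} (h : α =ᶠ[𝓝 x] β) : extDer α x = extDer β x := by
  have hx : chartExpr x α =ᶠ[𝓝 (extChartAt 𝓘(ℝ, E) x x)] chartExpr x β := by
    have hc : Filter.Tendsto (extChartAt 𝓘(ℝ, E) x).symm (𝓝 (extChartAt 𝓘(ℝ, E) x x)) (𝓝 x) := by
      have := (continuousAt_extChartAt_symm (I := 𝓘(ℝ, E)) x).tendsto
      rwa [extChartAt_to_inv] at this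
    filter_upwards [hc.eventually h] with y hy
    simp only [chartExpr, pullback, hy]
  simp only [extDer, hx.extDeriv_eq]

theorem IsSmoothOn.congr {α β : Form E M k} {U : Set M} (hα : IsSmoothOn α U)
    (h : ∀ x ∈ U, β x = α x) : IsSmoothOn β U := by
  intro x₀
  refine (hα x₀).congr fun y hy => ?_
  simp only [chartExpr, pullback, h _ hy.2]

variable {V : Type*} [NormedAddCommGroup V] [NormedSpace ℝ V] [IsManifold 𝓘(ℝ, E') ∞ P]
  {F : V → P} {O : Set V}

omit [IsManifold 𝓘(ℝ, E') ∞ P] in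
theorem eventually_mem_extChartAt_source {z : V} (hO : IsOpen O) (hz : z ∈ O)
    (hF : ContMDiffOn 𝓘(ℝ, V) 𝓘(ℝ, E') ∞ F O) :
    ∀ᶠ y in 𝓝 z, y ∈ O ∧ F y ∈ (extChartAt 𝓘(ℝ, E') (F z)).source :=
  Filter.Eventually.and (hO.mem_nhds hz)
    ((hF.contMDiffAt (hO.mem_nhds hz)).continuousAt.preimage_mem_nhds
      (extChartAt_source_mem_nhds (I := 𝓘(ℝ, E')) (F z)))

theorem contDiffAt_extChartAt_comp {z y : V} (hO : IsOpen O)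
    (hF : ContMDiffOn 𝓘(ℝ, V) 𝓘(ℝ, E') ∞ F O)
    (hy : y ∈ O ∧ F y ∈ (extChartAt 𝓘(ℝ, E') (F z)).source) :
    ContDiffAt ℝ ∞ (fun y => extChartAt 𝓘(ℝ, E') (F z) (F y)) y := by
  rw [← contMDiffAt_iff_contDiffAt]
  refine ContMDiffAt.comp y ?_ (hF.contMDiffAt (hO.mem_nhds hy.1))
  exact contMDiffAt_extChartAt' (by simpa using hy.2)

/-- A pullback to a vector space, computed in a chart. -/
theorem pullback_eq_chartExpr {z y : V} (hO : IsOpen O)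
    (hF : ContMDiffOn 𝓘(ℝ, V) 𝓘(ℝ, E') ∞ F O) (α : Form E' P k)
    (hy : y ∈ O ∧ F y ∈ (extChartAt 𝓘(ℝ, E') (F z)).source) :
    pullback (E := V) F α y = (chartExpr (F z) α
      (extChartAt 𝓘(ℝ, E') (F z) (F y))).compContinuousLinearMap
        (fderiv ℝ (fun y => extChartAt 𝓘(ℝ, E') (F z) (F y)) y) := by
  have h1 : F =ᶠ[𝓝 y] fun y => (extChartAt 𝓘(ℝ, E') (F z)).symm
      (extChartAt 𝓘(ℝ, E') (F z) (F y)) := by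
    have hs := (hF.contMDiffAt (hO.mem_nhds hy.1)).continuousAt.preimage_mem_nhds
      ((isOpen_extChartAt_source (I := 𝓘(ℝ, E')) (F z)).mem_nhds hy.2)
    filter_upwards [hs] with q hq
    exact ((extChartAt 𝓘(ℝ, E') (F z)).left_inv hq).symm
  rw [pullback_congr α h1]
  have h2 := contDiffAt_extChartAt_comp hO hF hy
  have h3 : ContMDiffAt 𝓘(ℝ, E') 𝓘(ℝ, E') ∞ (extChartAt 𝓘(ℝ, E') (F z)).symm
      (extChartAt 𝓘(ℝ, E') (F z) (F y)) :=
    (contMDiffOn_extChartAt_symm (F z)).contMDiffAt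
      ((isOpen_extChartAt_target (I := 𝓘(ℝ, E')) (F z)).mem_nhds
        ((extChartAt 𝓘(ℝ, E') (F z)).map_source hy.2))
  rw [pullback_comp (f := fun y => extChartAt 𝓘(ℝ, E') (F z) (F y)) α
    (h3.mdifferentiableAt (by simp))
    (h2.contMDiffAt.mdifferentiableAt (by simp)), ← mfderiv_eq_fderiv]
  rfl

omit [IsManifold 𝓘(ℝ, E') ∞ P] in
theorem contDiffAt_chartExpr {α : Form E' P k} (hα : IsSmoothOn α Set.univ) (p q : P)
    (hq : q ∈ (extChartAt 𝓘(ℝ, E') p).source) :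
    ContDiffAt ℝ ∞ (chartExpr p α) (extChartAt 𝓘(ℝ, E') p q) := by
  have h := hα p
  rw [Set.preimage_univ, Set.inter_univ] at h
  exact h.contDiffAt ((isOpen_extChartAt_target (I := 𝓘(ℝ, E')) p).mem_nhds
    ((extChartAt 𝓘(ℝ, E') p).map_source hq))

/-- The pullback of a smooth form under a smooth map from an open subset of a vector space is
smooth. -/
theorem contDiffOn_pullback [FiniteDimensional ℝ V] (hO : IsOpen O)
    (hF : ContMDiffOn 𝓘(ℝ, V) 𝓘(ℝ, E') ∞ F O) {α : Form E' P k} (hα : IsSmoothOn α Set.univ) :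
    ContDiffOn ℝ ∞ (pullback (E := V) F α) O := by
  intro z hz
  have hev := eventually_mem_extChartAt_source hO hz hF
  obtain ⟨N, hN, hNo, hzN⟩ := eventually_nhds_iff.1 hev
  have h1 : ContDiffOn ℝ ∞ (fun y => (chartExpr (F z) α
      (extChartAt 𝓘(ℝ, E') (F z) (F y))).compContinuousLinearMap
      (fderiv ℝ (fun y => extChartAt 𝓘(ℝ, E') (F z) (F y)) y)) N := by
    have h2 : ContDiffOn ℝ ∞ (fun y => extChartAt 𝓘(ℝ, E') (F z) (F y)) N :=
      fun y hy => (contDiffAt_extChartAt_comp hO hF (hN y hy)).contDiffWithinAt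
    refine contDiffOn_compContinuousLinearMap ?_ (h2.fderiv_of_isOpen hNo (by simp))
    exact fun y hy => (ContDiffAt.comp (f := fun y => extChartAt 𝓘(ℝ, E') (F z) (F y)) y
      (contDiffAt_chartExpr hα _ _ (hN y hy).2)
      (contDiffAt_extChartAt_comp hO hF (hN y hy))).contDiffWithinAt
  refine ((h1.congr fun y hy => pullback_eq_chartExpr hO hF α (hN y hy)).contDiffAt
    (hNo.mem_nhds hzN)).contDiffWithinAt

/-- The exterior derivative commutes with pullbacks to open subsets of vector spaces. -/
theorem extDeriv_pullback_eq (hO : IsOpen O) (hF : ContMDiffOn 𝓘(ℝ, V) 𝓘(ℝ, E') ∞ F O)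
    {α : Form E' P k} (hα : IsSmoothOn α Set.univ) {z : V} (hz : z ∈ O) :
    extDeriv (pullback (E := V) F α) z = pullback (E := V) F (extDer α) z := by
  have hev := eventually_mem_extChartAt_source hO hz hF
  have hzz := hev.self_of_nhds
  have h1 : pullback (E := V) F α =ᶠ[𝓝 z] fun y => (chartExpr (F z) α
      (extChartAt 𝓘(ℝ, E') (F z) (F y))).compContinuousLinearMap
      (fderiv ℝ (fun y => extChartAt 𝓘(ℝ, E') (F z) (F y)) y) :=
    hev.mono fun y hy => pullback_eq_chartExpr hO hF α hy
  have h2 := contDiffAt_extChartAt_comp hO hF hzz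
  have hd : DifferentiableAt ℝ (chartExpr (F z) α)
      ((fun y => extChartAt 𝓘(ℝ, E') (F z) (F y)) z) :=
    (contDiffAt_chartExpr hα _ _ hzz.2).differentiableAt (by simp)
  rw [h1.extDeriv_eq, _root_.extDeriv_pullback (f := fun y => extChartAt 𝓘(ℝ, E') (F z) (F y)) hd h2
    (by
      rw [minSmoothness_of_isRCLikeNormedField]
      exact WithTop.coe_le_coe.2 (le_top : (2 : ℕ∞) ≤ ⊤)),
    ← mfderiv_eq_fderiv]
  have h3 : MDifferentiableAt 𝓘(ℝ, E') 𝓘(ℝ, E') (extChartAt 𝓘(ℝ, E') (F z)) (F z) :=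
    (contMDiffAt_extChartAt' (n := ∞) (by simp)).mdifferentiableAt (by simp)
  have h4 : MDifferentiableAt 𝓘(ℝ, V) 𝓘(ℝ, E') F z :=
    (hF.contMDiffAt (hO.mem_nhds hz)).mdifferentiableAt (by simp)
  ext v
  have h5 := tangentMapAt_comp h3 h4
  simp only [tangentMapAt] at h5
  simp only [pullback, extDer, tangentMapAt, h5]
  rfl

end Pullback

/-! ### The circle action and the dependence of the fibre integral on the section -/

section Annihilation

variable {E : Type*} [NormedAddCommGroup E] [NormedSpace ℝ E]
  {F : Type*} [NormedAddCommGroup F] [NormedSpace ℝ F] {k : ℕ}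

theorem contract_eq_zero_of_eq (α : E [⋀^Fin (k + 1)]→L[ℝ] ℂ) (u : E) (v : Fin k → E)
    (hv : ∃ a, v a = u) : contract u α v = 0 := by
  obtain ⟨a, ha⟩ := hv
  exact α.map_eq_zero_of_eq (Fin.cons u v) (i := 0) (j := a.succ) (by simpa using ha.symm)
    (Fin.succ_ne_zero a).symm

/-- A form annihilated by `u` only depends on its arguments modulo `u`. -/
theorem compContinuousLinearMap_eq_of_sub_mem (β : F [⋀^Fin k]→L[ℝ] ℂ) (u : F)
    (hu : ∀ v : Fin k → F, (∃ a, v a = u) → β v = 0) {f g : E →L[ℝ] F}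
    (hfg : ∀ v, ∃ c : ℝ, f v - g v = c • u) :
    β.compContinuousLinearMap f = β.compContinuousLinearMap g := by
  choose c hc using hfg
  ext v
  have h1 : (f ∘ v) = (fun a => c (v a) • u) + g ∘ v := by
    funext a
    simp [← hc]
  rw [ContinuousAlternatingMap.compContinuousLinearMap_apply,
    ContinuousAlternatingMap.compContinuousLinearMap_apply]
  change β (f ∘ v) = β (g ∘ v)
  rw [h1]
  refine (β.toMultilinearMap.map_add_univ _ _).trans ?_
  rw [Finset.sum_eq_single ∅]
  · simp
  · intro s _ hs
    obtain ⟨a, ha⟩ := Finset.nonempty_iff_ne_empty.2 hs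
    set m := s.piecewise (fun a => c (v a) • u) (g ∘ v)
    have hm : m = Function.update m a (c (v a) • u) := by
      rw [eq_comm, Function.update_eq_self_iff]
      simp [m, ha]
    rw [hm, MultilinearMap.map_update_smul]
    refine smul_eq_zero_of_right _ (hu _ ⟨a, by simp⟩)
  · simp

end Annihilation

section Circle

variable {E : Type*} [NormedAddCommGroup E] [NormedSpace ℝ E]
  {M : Type*} [TopologicalSpace M] [ChartedSpace E M]
  {E' : Type*} [NormedAddCommGroup E'] [NormedSpace ℝ E']
  {P : Type*} [TopologicalSpace P] [ChartedSpace E' P] [MulAction Circle P] {pr : P → M}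

omit [TopologicalSpace P] in
theorem rot_add (s t : ℝ) (p : P) : rot (s + t) p = rot s (rot t p) := by
  rw [rot, rot, rot, smul_smul, mul_add, Circle.exp_add]

omit [TopologicalSpace P] in
theorem rot_zero (p : P) : rot 0 p = p := by simp [rot]

omit [TopologicalSpace P] in
theorem rot_one (p : P) : rot 1 p = p := by simp [rot]

omit [TopologicalSpace P] in
theorem exists_rot_eq_smul (u : Circle) : ∃ t : ℝ, ∀ p : P, u • p = rot t p := by
  refine ⟨Complex.arg u / (2 * Real.pi), fun p => ?_⟩
  rw [rot, mul_div_cancel₀ _ (by positivity), Circle.exp_arg]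

theorem IsPrincipalCircleBundle.contMDiff_rot (hpr : IsPrincipalCircleBundle E E' pr) :
    ContMDiff (𝓘(ℝ, ℝ).prod 𝓘(ℝ, E')) 𝓘(ℝ, E') ∞ fun q : ℝ × P => rot q.1 q.2 := by
  refine hpr.smooth_smul.comp (f := fun q : ℝ × P => (Circle.exp (2 * Real.pi * q.1), q.2)) ?_
  refine ContMDiff.prodMk ?_ contMDiff_snd
  refine contMDiff_circleExp.comp (f := fun q : ℝ × P => 2 * Real.pi * q.1) ?_
  have h : ContMDiff 𝓘(ℝ, ℝ) 𝓘(ℝ, ℝ) ∞ fun t : ℝ => 2 * Real.pi * t :=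
    (contDiff_const.mul contDiff_id).contMDiff
  exact h.comp contMDiff_fst

theorem IsPrincipalCircleBundle.contMDiff_rot_left (hpr : IsPrincipalCircleBundle E E' pr)
    (p : P) : ContMDiff 𝓘(ℝ, ℝ) 𝓘(ℝ, E') ∞ fun t : ℝ => rot t p :=
  hpr.contMDiff_rot.comp (contMDiff_id.prodMk contMDiff_const)

theorem IsPrincipalCircleBundle.contMDiff_rot_right (hpr : IsPrincipalCircleBundle E E' pr)
    (t : ℝ) : ContMDiff 𝓘(ℝ, E') 𝓘(ℝ, E') ∞ fun p : P => rot t p :=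
  hpr.contMDiff_rot.comp (contMDiff_const.prodMk contMDiff_id)

theorem IsPrincipalCircleBundle.vert_rot (hpr : IsPrincipalCircleBundle E E' pr) (t : ℝ) (p : P) :
    (vert (rot t p) : E') = tangentMapAt (E := ℝ) (E' := E') (fun τ : ℝ => rot τ p) t 1 := by
  have h1 : (fun τ : ℝ => rot τ (rot t p)) = fun τ => rot (τ + t) p := by
    funext τ
    rw [rot_add]
  have h2 : HasMFDerivAt 𝓘(ℝ, ℝ) 𝓘(ℝ, ℝ) (fun τ : ℝ => τ + t) 0 (ContinuousLinearMap.id ℝ ℝ) :=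
    ((hasFDerivAt_id (𝕜 := ℝ) (0 : ℝ)).add_const t).hasMFDerivAt
  have h3 : MDifferentiableAt 𝓘(ℝ, ℝ) 𝓘(ℝ, E') (fun τ : ℝ => rot τ p) ((0 : ℝ) + t) :=
    (hpr.contMDiff_rot_left p).mdifferentiableAt (by simp)
  have h4 := (h3.hasMFDerivAt.comp (0 : ℝ) h2).mfderiv
  rw [vert, h1]
  refine (congrArg (fun L : ℝ →L[ℝ] E' => L 1) h4).trans ?_
  rw [zero_add]
  rfl

/-- The chain rule for a rotation with variable angle. -/
theorem IsPrincipalCircleBundle.tangentMapAt_rot (hpr : IsPrincipalCircleBundle E E' pr)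
    {X : Type*} [NormedAddCommGroup X] [NormedSpace ℝ X] {N : Type*} [TopologicalSpace N]
    [ChartedSpace X N] {τ : N → ℝ} {q : N → P} {x : N}
    (hτ : MDifferentiableAt 𝓘(ℝ, X) 𝓘(ℝ, ℝ) τ x) (hq : MDifferentiableAt 𝓘(ℝ, X) 𝓘(ℝ, E') q x)
    (v : X) :
    tangentMapAt (E' := E') (fun y => rot (τ y) (q y)) x v =
      tangentMapAt (E := X) (E' := ℝ) τ x v • (vert (rot (τ x) (q x)) : E') +
        tangentMapAt (E' := E') (fun y => rot (τ x) (q y)) x v := by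
  have hR : MDifferentiableAt (𝓘(ℝ, ℝ).prod 𝓘(ℝ, E')) 𝓘(ℝ, E')
      (fun q : ℝ × P => rot q.1 q.2) (τ x, q x) := hpr.contMDiff_rot.mdifferentiableAt (by simp)
  have h1 := mfderiv_comp x (g := fun q : ℝ × P => rot q.1 q.2) (f := fun y => (τ y, q y))
    hR (hτ.prodMk hq)
  have h2 := mfderiv_prod_eq_add_apply (v := (mfderiv 𝓘(ℝ, X) (𝓘(ℝ, ℝ).prod 𝓘(ℝ, E'))
    (fun y => (τ y, q y)) x) v) hR
  have h3 : mfderiv 𝓘(ℝ, X) (𝓘(ℝ, ℝ).prod 𝓘(ℝ, E')) (fun y => (τ y, q y)) x =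
      (mfderiv 𝓘(ℝ, X) 𝓘(ℝ, ℝ) τ x).prod (mfderiv 𝓘(ℝ, X) 𝓘(ℝ, E') q x) := hτ.mfderiv_prod hq
  have h4 := mfderiv_comp x (g := fun p : P => rot (τ x) p) (f := q)
    ((hpr.contMDiff_rot_right (τ x)).mdifferentiableAt (by simp)) hq
  rw [h3] at h2
  have h5 : tangentMapAt (E' := E') (fun y => rot (τ y) (q y)) x v =
      (mfderiv (𝓘(ℝ, ℝ).prod 𝓘(ℝ, E')) 𝓘(ℝ, E') (fun q : ℝ × P => rot q.1 q.2) (τ x, q x))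
        ((mfderiv 𝓘(ℝ, X) (𝓘(ℝ, ℝ).prod 𝓘(ℝ, E')) (fun y => (τ y, q y)) x) v) :=
    congrArg (fun L : X →L[ℝ] E' => L v) h1
  rw [h5, h3]
  refine h2.trans (congrArg₂ (fun a b : E' => a + b) ?_ ?_)
  · rw [hpr.vert_rot, ← map_smul]
    refine congrArg (mfderiv 𝓘(ℝ, ℝ) 𝓘(ℝ, E') (fun τ : ℝ => rot τ (q x)) (τ x)) ?_
    exact (mul_one (M := ℝ) _).symm
  · exact (congrArg (fun L : X →L[ℝ] E' => L v) h4).symm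

theorem IsPrincipalCircleBundle.contMDiff_proj (hpr : IsPrincipalCircleBundle E E' pr) :
    ContMDiff 𝓘(ℝ, E') 𝓘(ℝ, E) ∞ pr := by
  intro p
  obtain ⟨e, hp, he, -, -⟩ := hpr.exists_trivialization (pr p)
  have hps : p ∈ e.source := e.mem_source.2 hp
  have h1 := (he.contMDiffAt (e.open_source.mem_nhds hps)).fst
  refine h1.congr_of_eventuallyEq ?_
  filter_upwards [e.open_source.mem_nhds hps] with q hq
  exact (e.coe_fst hq).symm

theorem IsPrincipalCircleBundle.proj_rot (hpr : IsPrincipalCircleBundle E E' pr) (t : ℝ) (p : P) :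
    pr (rot t p) = pr p := hpr.proj_smul _ _

theorem IsPrincipalCircleBundle.tangentMapAt_proj_vert (hpr : IsPrincipalCircleBundle E E' pr)
    (p : P) : tangentMapAt (E := E') (E' := E) pr p (vert p) = 0 := by
  have h1 : MDifferentiableAt 𝓘(ℝ, ℝ) 𝓘(ℝ, E') (fun t : ℝ => rot t p) 0 :=
    (hpr.contMDiff_rot_left p).mdifferentiableAt (by simp)
  have h2 : MDifferentiableAt 𝓘(ℝ, E') 𝓘(ℝ, E) pr (rot 0 p) :=
    hpr.contMDiff_proj.mdifferentiableAt (by simp)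
  have h3 := tangentMapAt_comp (f := fun t : ℝ => rot t p) h2 h1
  simp only [hpr.proj_rot, rot_zero] at h3
  have h4 : tangentMapAt (E := ℝ) (E' := E) (fun _ : ℝ => pr p) 0 = 0 := mfderiv_const
  rw [h4] at h3
  exact (congrArg (fun L : ℝ →L[ℝ] E => L 1) h3).symm

/-- Two points in the same fibre differ by a rotation. -/
theorem IsPrincipalCircleBundle.exists_eq_rot (hpr : IsPrincipalCircleBundle E E' pr) {p q : P}
    (h : pr p = pr q) : ∃ t : ℝ, q = rot t p := by
  obtain ⟨e, hp, -, -, he⟩ := hpr.exists_trivialization (pr p)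
  have hps : p ∈ e.source := e.mem_source.2 hp
  have hqs : q ∈ e.source := e.mem_source.2 (h ▸ hp)
  obtain ⟨t, ht⟩ := exists_rot_eq_smul (P := P) ((e q).2 * ((e p).2)⁻¹)
  refine ⟨t, ?_⟩
  rw [← ht]
  refine e.injOn hqs (e.mem_source.2 (by rwa [hpr.proj_smul])) ?_
  change e q = e (((e q).2 * ((e p).2)⁻¹) • p)
  rw [he _ _ hps, inv_mul_cancel_right, e.coe_fst hps, h, ← e.coe_fst hqs]

/-- The vertical tangent vectors are the multiples of `∂/∂t`. -/
theorem IsPrincipalCircleBundle.exists_eq_smul_vert (hpr : IsPrincipalCircleBundle E E' pr)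
    (p : P) (v : E') (hv : tangentMapAt (E := E') (E' := E) pr p v = 0) :
    ∃ c : ℝ, v = c • vert p := by
  obtain ⟨e, hp, he, hes, heq⟩ := hpr.exists_trivialization (pr p)
  have hps : p ∈ e.source := e.mem_source.2 hp
  -- near `p`, a point `q` is the rotation by the angle `τ q` of the section through `p`
  set s : M → P := fun y => e.toOpenPartialHomeomorph.symm (y, (e p).2) with hs
  set g : P → Circle := fun q => (e q).2 * ((e p).2)⁻¹ with hg
  set τ : P → ℝ := fun q => Complex.arg (g q) / (2 * Real.pi) with hτ
  have hgp : g p = 1 := by simp [hg]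
  have hτp : τ p = 0 := by simp [hτ, hgp]
  have hsp : s (pr p) = p := by
    rw [hs, ← e.coe_fst hps]
    exact e.toOpenPartialHomeomorph.left_inv hps
  have hrot : ∀ q ∈ e.source, rot (τ q) (s (pr q)) = q := by
    intro q hq
    have hqb : pr q ∈ e.baseSet := e.mem_source.1 hq
    have hst : (pr q, (e p).2) ∈ e.target := by simpa [e.target_eq] using hqb
    have hss : s (pr q) ∈ e.source := e.toOpenPartialHomeomorph.map_target hst
    have h1 : rot (τ q) (s (pr q)) = g q • s (pr q) := by
      rw [rot, hτ, mul_div_cancel₀ _ (by positivity), Circle.exp_arg]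
    have h2 : e (s (pr q)) = (pr q, (e p).2) := e.toOpenPartialHomeomorph.right_inv hst
    rw [h1]
    refine e.injOn (e.mem_source.2 ?_) hq ?_
    · rw [hpr.proj_smul]
      exact e.mem_source.1 hss
    · change e (g q • s (pr q)) = e q
      rw [heq _ _ hss, h2]
      simp only [hg, inv_mul_cancel_right]
      exact Prod.ext (e.coe_fst hq).symm rfl
  have hgs : ContMDiffAt 𝓘(ℝ, E') (𝓡 1) ∞ g p :=
    ((he.contMDiffAt (e.open_source.mem_nhds hps)).snd).mul contMDiffAt_const
  have hgc : ContMDiffAt 𝓘(ℝ, E') 𝓘(ℝ, ℂ) ∞ (fun q => (g q : ℂ)) p := by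
    have := finrank_real_complex_fact'
    exact (contMDiff_coe_sphere (E := ℂ) (n := 1)).contMDiffAt.comp p hgs
  have hτs : ContMDiffAt 𝓘(ℝ, E') 𝓘(ℝ, ℝ) ∞ τ p := by
    have h1 : ContDiffAt ℝ ∞ (fun w : ℂ => Complex.arg w / (2 * Real.pi)) (g p : ℂ) := by
      have h2 : ContDiffAt ℂ ∞ Complex.log (g p : ℂ) := by
        refine Complex.contDiffAt_log ?_
        simp [hgp]
      have h3 := (Complex.imCLM.contDiff.contDiffAt.comp (g p : ℂ)
        (h2.restrict_scalars ℝ)).div_const (2 * Real.pi)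
      refine h3.congr_of_eventuallyEq (Filter.Eventually.of_forall fun w => ?_)
      simp [Complex.log_im]
    exact h1.contMDiffAt.comp p hgc
  have hss : ContMDiffAt 𝓘(ℝ, E) 𝓘(ℝ, E') ∞ s (pr p) := by
    have ht : (pr p, (e p).2) ∈ e.target := by simpa [e.target_eq] using hp
    exact (hes.contMDiffAt (e.open_target.mem_nhds ht)).comp (pr p)
      (contMDiffAt_id.prodMk contMDiffAt_const)
  have hsd : MDifferentiableAt 𝓘(ℝ, E) 𝓘(ℝ, E') s (pr p) := hss.mdifferentiableAt (by simp)
  have hpd : MDifferentiableAt 𝓘(ℝ, E') 𝓘(ℝ, E) pr p :=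
    hpr.contMDiff_proj.mdifferentiableAt (by simp)
  have hid : (fun q => rot (τ q) (s (pr q))) =ᶠ[𝓝 p] fun q => q := by
    filter_upwards [e.open_source.mem_nhds hps] with q hq using hrot q hq
  have h1 := hpr.tangentMapAt_rot (τ := τ) (q := fun q => s (pr q)) (x := p)
    (hτs.mdifferentiableAt (by simp)) (hsd.comp p hpd) v
  rw [tangentMapAt_congr hid] at h1
  have h2 : tangentMapAt (E := E') (E' := E') (fun q : P => q) p v = v :=
    congrArg (fun L : E' →L[ℝ] E' => L v) (mfderiv_id (I := 𝓘(ℝ, E')) (x := p))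
  have h3 : tangentMapAt (E := E') (E' := E') (fun q : P => s (pr q)) p v = 0 := by
    rw [tangentMapAt_comp hsd hpd, ContinuousLinearMap.comp_apply, hv, map_zero]
  rw [h2, hτp] at h1
  simp only [rot_zero, h3, hsp, add_zero] at h1
  exact ⟨_, h1⟩

/-- The component at the angle `t` of the fibre over `x`, in the trivialization given by `s`, of
the form `β` in `α = dt ∧ β + γ`. -/
noncomputable def fiberVert (s : LocalSection E E' pr) {k : ℕ} (α : Form E' P (k + 1)) (x : M)
    (t : ℝ) : E [⋀^Fin k]→L[ℝ] ℂ :=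
  (contract (vert (rot t (s.toFun x))) (α (rot t (s.toFun x)))).compContinuousLinearMap
    (tangentMapAt (fun y => rot t (s.toFun y)) x)

theorem fiberIntegralIn_eq (s : LocalSection E E' pr) (n : ℤ) {k : ℕ} (α : Form E' P (k + 1))
    (x : M) : fiberIntegralIn s n α x = ∫ t in (0 : ℝ)..1, character n t • fiberVert s α x t :=
  rfl

variable (s s' : LocalSection E E' pr) {x : M}

omit [MulAction Circle P] in
theorem LocalSection.contMDiffAt (hx : x ∈ s.U) :
    ContMDiffAt 𝓘(ℝ, E) 𝓘(ℝ, E') ∞ s.toFun x :=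
  s.smooth.contMDiffAt (s.isOpen.mem_nhds hx)

theorem LocalSection.mdifferentiableAt_rot (hpr : IsPrincipalCircleBundle E E' pr) (t : ℝ)
    (hx : x ∈ s.U) : MDifferentiableAt 𝓘(ℝ, E) 𝓘(ℝ, E') (fun y => rot t (s.toFun y)) x :=
  (((hpr.contMDiff_rot_right t).contMDiffAt (x := s.toFun x)).comp x
    (s.contMDiffAt hx)).mdifferentiableAt (by simp)

/-- The rotated section lifts tangent vectors. -/
theorem LocalSection.tangentMapAt_proj_rot (hpr : IsPrincipalCircleBundle E E' pr) (t : ℝ)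
    (hx : x ∈ s.U) :
    (tangentMapAt (E := E') (E' := E) pr (rot t (s.toFun x))).comp
      (tangentMapAt (E := E) (E' := E') (fun y => rot t (s.toFun y)) x) =
        ContinuousLinearMap.id ℝ E := by
  have h1 := tangentMapAt_comp (g := pr) (f := fun y => rot t (s.toFun y)) (x := x)
    (hpr.contMDiff_proj.mdifferentiableAt (by simp)) (s.mdifferentiableAt_rot hpr t hx)
  have h2 : (fun y => pr (rot t (s.toFun y))) =ᶠ[𝓝 x] fun y => y := by
    filter_upwards [s.isOpen.mem_nhds hx] with y hy
    rw [hpr.proj_rot, s.proj y hy]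
  rw [← h1, tangentMapAt_congr h2]
  exact mfderiv_id

/-- The `dt`-component may be computed with any lift of the tangent vectors. -/
theorem fiberVert_eq_of_lift (hpr : IsPrincipalCircleBundle E E' pr) (hx : x ∈ s.U) {k : ℕ}
    (α : Form E' P (k + 1)) (t : ℝ) (f : E →L[ℝ] E')
    (hf : (tangentMapAt (E := E') (E' := E) pr (rot t (s.toFun x))).comp f =
      ContinuousLinearMap.id ℝ E) :
    fiberVert s α x t = (contract (vert (rot t (s.toFun x)))
      (α (rot t (s.toFun x)))).compContinuousLinearMap f := by
  refine compContinuousLinearMap_eq_of_sub_mem _ (vert (rot t (s.toFun x)))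
    (contract_eq_zero_of_eq _ _) fun v => hpr.exists_eq_smul_vert _ _ ?_
  have h1 := congrArg (fun L : E →L[ℝ] E => L v) (s.tangentMapAt_proj_rot hpr t hx)
  have h2 := congrArg (fun L : E →L[ℝ] E => L v) hf
  simp only [ContinuousLinearMap.comp_apply] at h1 h2
  rw [map_sub, h1, h2, sub_self]

theorem fiberVert_add_one {k : ℕ} (α : Form E' P (k + 1)) (t : ℝ) :
    fiberVert s α x (t + 1) = fiberVert s α x t := by
  simp only [fiberVert, rot_add, rot_one]

theorem fiberVert_of_eq_rot (hpr : IsPrincipalCircleBundle E E' pr) (hx : x ∈ s.U)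
    (hx' : x ∈ s'.U) {τ : ℝ} (hτ : s'.toFun x = rot τ (s.toFun x)) {k : ℕ}
    (α : Form E' P (k + 1)) (t : ℝ) : fiberVert s' α x t = fiberVert s α x (t + τ) := by
  have h1 : rot t (s'.toFun x) = rot (t + τ) (s.toFun x) := by rw [hτ, rot_add]
  rw [fiberVert_eq_of_lift s hpr hx α (t + τ)
    (tangentMapAt (E := E) (E' := E') (fun y => rot t (s'.toFun y)) x)]
  · simp only [fiberVert, h1]
  · rw [← h1]
    exact s'.tangentMapAt_proj_rot hpr t hx'

/-- The dependence of the fibre integral on the section. -/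
theorem fiberIntegralIn_of_eq_rot (hpr : IsPrincipalCircleBundle E E' pr) (hx : x ∈ s.U)
    (hx' : x ∈ s'.U) {τ : ℝ} (hτ : s'.toFun x = rot τ (s.toFun x)) (n : ℤ) {k : ℕ}
    (α : Form E' P (k + 1)) :
    fiberIntegralIn s' n α x = character n (-τ) • fiberIntegralIn s n α x := by
  have hper : Function.Periodic (fun t => character n t • fiberVert s α x t) 1 := fun t => by
    simp only [fiberVert_add_one, character_add, character_one, mul_one]
  have h1 := hper.intervalIntegral_add_eq τ 0
  rw [zero_add] at h1
  rw [fiberIntegralIn_eq, fiberIntegralIn_eq, ← h1, ← intervalIntegral.integral_smul]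
  have h2 := intervalIntegral.integral_comp_add_right (a := 0) (b := 1)
    (fun t => character n (-τ) • character n t • fiberVert s α x t) τ
  rw [zero_add, add_comm 1 τ] at h2
  rw [← h2]
  refine intervalIntegral.integral_congr fun t _ => ?_
  simp only [fiberVert_of_eq_rot s s' hpr hx hx' hτ, smul_smul, ← character_add]
  rw [add_comm t τ, neg_add_cancel_left]

end Circle

/-! ### The fibre integral in a trivialization: smoothness and exterior derivative -/

section Cylinder

variable {E : Type*} [NormedAddCommGroup E] [NormedSpace ℝ E]
  {M : Type*} [TopologicalSpace M] [ChartedSpace E M]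
  {E' : Type*} [NormedAddCommGroup E'] [NormedSpace ℝ E']
  {P : Type*} [TopologicalSpace P] [ChartedSpace E' P] [MulAction Circle P] {pr : P → M}
  (s : LocalSection E E' pr) {x : M} {k : ℕ}

/-- The component at the angle `t` of the fibre over `x`, in the trivialization given by `s`, of
the form `γ` in `α = dt ∧ β + γ`. -/
noncomputable def fiberHoriz (α : Form E' P k) (x : M) (t : ℝ) : E [⋀^Fin k]→L[ℝ] ℂ :=
  pullback (fun y => rot t (s.toFun y)) α x

/-- The trivialization given by `s`, written in the chart of `M` at `x`. -/
noncomputable def cylinder (x : M) (q : E × ℝ) : P :=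
  rot q.2 (s.toFun ((extChartAt 𝓘(ℝ, E) x).symm q.1))

/-- The part of the chart at `x` on which the section `s` is defined. -/
def chartDomain (x : M) : Set E :=
  (extChartAt 𝓘(ℝ, E) x).target ∩ (extChartAt 𝓘(ℝ, E) x).symm ⁻¹' s.U

omit [MulAction Circle P] in
theorem isOpen_chartDomain (x : M) : IsOpen (chartDomain s x) :=
  (continuousOn_extChartAt_symm x).isOpen_inter_preimage (isOpen_extChartAt_target x) s.isOpen

omit [MulAction Circle P] in
theorem extChartAt_mem_chartDomain (hx : x ∈ s.U) :
    extChartAt 𝓘(ℝ, E) x x ∈ chartDomain s x :=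
  ⟨mem_extChartAt_target x, by rwa [Set.mem_preimage, extChartAt_to_inv]⟩

variable [IsManifold 𝓘(ℝ, E) ∞ M]

theorem contMDiffAt_extChartAt_symm_of_mem {x : M} {z : E}
    (hz : z ∈ (extChartAt 𝓘(ℝ, E) x).target) :
    ContMDiffAt 𝓘(ℝ, E) 𝓘(ℝ, E) ∞ (extChartAt 𝓘(ℝ, E) x).symm z :=
  (contMDiffOn_extChartAt_symm x).contMDiffAt ((isOpen_extChartAt_target x).mem_nhds hz)

variable (hpr : IsPrincipalCircleBundle E E' pr)
include hpr

theorem contMDiffOn_cylinder (x : M) :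
    ContMDiffOn 𝓘(ℝ, E × ℝ) 𝓘(ℝ, E') ∞ (cylinder s x) (chartDomain s x ×ˢ Set.univ) := by
  intro q hq
  have h1 : ContMDiffAt 𝓘(ℝ, E × ℝ) 𝓘(ℝ, E) ∞ (fun q : E × ℝ => q.1) q :=
    contDiff_fst.contMDiff.contMDiffAt
  have h2 : ContMDiffAt 𝓘(ℝ, E × ℝ) 𝓘(ℝ, ℝ) ∞ (fun q : E × ℝ => q.2) q :=
    contDiff_snd.contMDiff.contMDiffAt
  have h3 := ((s.contMDiffAt hq.1.2).comp q.1 (contMDiffAt_extChartAt_symm_of_mem hq.1.1)).comp q h1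
  exact ((hpr.contMDiff_rot.contMDiffAt (x := (q.2, _))).comp q
    (h2.prodMk h3)).contMDiffWithinAt

/-- The trivialization maps `(0, 1)` to `∂/∂t`, and its restriction to the slice at `t` is the
section rotated by `t`. -/
theorem tangentMapAt_cylinder {z : E} (hz : z ∈ chartDomain s x) (t : ℝ) (v : E × ℝ) :
    tangentMapAt (E := E × ℝ) (E' := E') (cylinder s x) (z, t) v =
      v.2 • (vert (cylinder s x (z, t)) : E') +
        tangentMapAt (E := E) (E' := E') (fun y => rot t (s.toFun y))
          ((extChartAt 𝓘(ℝ, E) x).symm z)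
          (tangentMapAt (E := E) (E' := E) (extChartAt 𝓘(ℝ, E) x).symm z v.1) := by
  have h1 : MDifferentiableAt 𝓘(ℝ, E × ℝ) 𝓘(ℝ, E) (fun q : E × ℝ => q.1) (z, t) :=
    (contDiff_fst (n := ∞)).contMDiff.contMDiffAt.mdifferentiableAt (by simp)
  have h2 : MDifferentiableAt 𝓘(ℝ, E × ℝ) 𝓘(ℝ, ℝ) (fun q : E × ℝ => q.2) (z, t) :=
    (contDiff_snd (n := ∞)).contMDiff.contMDiffAt.mdifferentiableAt (by simp)
  have h3 : MDifferentiableAt 𝓘(ℝ, E) 𝓘(ℝ, E) (extChartAt 𝓘(ℝ, E) x).symm z :=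
    (contMDiffAt_extChartAt_symm_of_mem hz.1).mdifferentiableAt (by simp)
  have h31 : MDifferentiableAt 𝓘(ℝ, E × ℝ) 𝓘(ℝ, E)
      (fun q : E × ℝ => (extChartAt 𝓘(ℝ, E) x).symm q.1) (z, t) :=
    MDifferentiableAt.comp (g := (extChartAt 𝓘(ℝ, E) x).symm) (z, t) h3 h1
  have h4 : MDifferentiableAt 𝓘(ℝ, E) 𝓘(ℝ, E') s.toFun ((extChartAt 𝓘(ℝ, E) x).symm z) :=
    (s.contMDiffAt hz.2).mdifferentiableAt (by simp)
  have h5 := hpr.tangentMapAt_rot (x := (z, t)) (τ := fun q : E × ℝ => q.2)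
    (q := fun q : E × ℝ => s.toFun ((extChartAt 𝓘(ℝ, E) x).symm q.1)) h2
    (MDifferentiableAt.comp (g := s.toFun) (z, t) h4 h31) v
  have h6 := tangentMapAt_comp (f := fun q : E × ℝ => (extChartAt 𝓘(ℝ, E) x).symm q.1)
    (g := fun y => rot t (s.toFun y)) (x := (z, t)) (s.mdifferentiableAt_rot hpr t hz.2) h31
  have h7 := tangentMapAt_comp (f := fun q : E × ℝ => q.1)
    (g := (extChartAt 𝓘(ℝ, E) x).symm) (x := (z, t)) h3 h1
  have h8 : tangentMapAt (E := E × ℝ) (E' := E) (fun q : E × ℝ => q.1) (z, t) =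
      ContinuousLinearMap.fst ℝ E ℝ := by
    rw [tangentMapAt, mfderiv_eq_fderiv, fderiv_fst]
  have h9 : tangentMapAt (E := E × ℝ) (E' := ℝ) (fun q : E × ℝ => q.2) (z, t) =
      ContinuousLinearMap.snd ℝ E ℝ := by
    rw [tangentMapAt, mfderiv_eq_fderiv, fderiv_snd]
  rw [h7, h8] at h6
  rw [h9, h6] at h5
  exact h5

theorem vertPart_pullback_cylinder {z : E} (hz : z ∈ chartDomain s x) (α : Form E' P (k + 1))
    (t : ℝ) :
    vertPart E k (pullback (E := E × ℝ) (cylinder s x) α (z, t)) =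
      (fiberVert s α ((extChartAt 𝓘(ℝ, E) x).symm z) t).compContinuousLinearMap
        (tangentMapAt (E := E) (E' := E) (extChartAt 𝓘(ℝ, E) x).symm z) := by
  ext v
  rw [vertPart_apply]
  change α (cylinder s x (z, t)) (fun a => tangentMapAt (E := E × ℝ) (E' := E') (cylinder s x)
    (z, t) ((Fin.cons (0, 1) fun a => (v a, 0) : Fin (k + 1) → E × ℝ) a)) =
    α (cylinder s x (z, t)) (Fin.cons (vert (cylinder s x (z, t)))
      fun a => tangentMapAt (E := E) (E' := E') (fun y => rot t (s.toFun y))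
          ((extChartAt 𝓘(ℝ, E) x).symm z)
          (tangentMapAt (E := E) (E' := E) (extChartAt 𝓘(ℝ, E) x).symm z (v a)))
  congr 1
  funext a
  rw [tangentMapAt_cylinder s hpr hz]
  refine Fin.cases ?_ (fun a => ?_) a <;> simp

theorem horizPart_pullback_cylinder {z : E} (hz : z ∈ chartDomain s x) (α : Form E' P k)
    (t : ℝ) :
    horizPart E k (pullback (E := E × ℝ) (cylinder s x) α (z, t)) =
      (fiberHoriz s α ((extChartAt 𝓘(ℝ, E) x).symm z) t).compContinuousLinearMap
        (tangentMapAt (E := E) (E' := E) (extChartAt 𝓘(ℝ, E) x).symm z) := by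
  ext v
  rw [horizPart_apply]
  change α (cylinder s x (z, t)) (fun a => tangentMapAt (E := E × ℝ) (E' := E') (cylinder s x)
    (z, t) (v a, 0)) =
    α (cylinder s x (z, t))
      fun a => tangentMapAt (E := E) (E' := E') (fun y => rot t (s.toFun y))
          ((extChartAt 𝓘(ℝ, E) x).symm z)
          (tangentMapAt (E := E) (E' := E) (extChartAt 𝓘(ℝ, E) x).symm z (v a))
  congr 1
  funext a
  rw [tangentMapAt_cylinder s hpr hz]
  simp

omit hpr s [MulAction Circle P] in
theorem compContinuousLinearMap_extChartAt (x : M) (β : E [⋀^Fin k]→L[ℝ] ℂ) :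
    (β.compContinuousLinearMap (tangentMapAt (E := E) (E' := E) (extChartAt 𝓘(ℝ, E) x).symm
      (extChartAt 𝓘(ℝ, E) x x))).compContinuousLinearMap
        (tangentMapAt (E := E) (E' := E) (extChartAt 𝓘(ℝ, E) x) x) = β := by
  have h1 : MDifferentiableAt 𝓘(ℝ, E) 𝓘(ℝ, E) (extChartAt 𝓘(ℝ, E) x).symm
      (extChartAt 𝓘(ℝ, E) x x) :=
    (contMDiffAt_extChartAt_symm_of_mem (mem_extChartAt_target x)).mdifferentiableAt (by simp)
  have h2 : MDifferentiableAt 𝓘(ℝ, E) 𝓘(ℝ, E) (extChartAt 𝓘(ℝ, E) x) x :=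
    (contMDiffAt_extChartAt (n := ∞)).mdifferentiableAt (by simp)
  have h3 := tangentMapAt_comp h1 h2
  have h4 : (fun y => (extChartAt 𝓘(ℝ, E) x).symm (extChartAt 𝓘(ℝ, E) x y)) =ᶠ[𝓝 x]
      fun y => y := by
    filter_upwards [extChartAt_source_mem_nhds (I := 𝓘(ℝ, E)) x] with y hy
    exact (extChartAt 𝓘(ℝ, E) x).left_inv hy
  rw [tangentMapAt_congr h4] at h3
  have h5 : tangentMapAt (E := E) (E' := E) (fun y : M => y) x = ContinuousLinearMap.id ℝ E :=
    mfderiv_id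
  rw [h5] at h3
  ext v
  change β (fun a => ((tangentMapAt (E := E) (E' := E) (extChartAt 𝓘(ℝ, E) x).symm
      (extChartAt 𝓘(ℝ, E) x x)).comp
        (tangentMapAt (E := E) (E' := E) (extChartAt 𝓘(ℝ, E) x) x)) (v a)) = β v
  rw [← h3]
  rfl

theorem fiberVert_eq (hx : x ∈ s.U) (α : Form E' P (k + 1)) (t : ℝ) :
    fiberVert s α x t = (vertPart E k (pullback (E := E × ℝ) (cylinder s x) α
      (extChartAt 𝓘(ℝ, E) x x, t))).compContinuousLinearMap
        (tangentMapAt (E := E) (E' := E) (extChartAt 𝓘(ℝ, E) x) x) := by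
  rw [vertPart_pullback_cylinder s hpr (extChartAt_mem_chartDomain s hx), extChartAt_to_inv,
    compContinuousLinearMap_extChartAt]

theorem fiberHoriz_eq (hx : x ∈ s.U) (α : Form E' P k) (t : ℝ) :
    fiberHoriz s α x t = (horizPart E k (pullback (E := E × ℝ) (cylinder s x) α
      (extChartAt 𝓘(ℝ, E) x x, t))).compContinuousLinearMap
        (tangentMapAt (E := E) (E' := E) (extChartAt 𝓘(ℝ, E) x) x) := by
  rw [horizPart_pullback_cylinder s hpr (extChartAt_mem_chartDomain s hx), extChartAt_to_inv,
    compContinuousLinearMap_extChartAt]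

variable [FiniteDimensional ℝ E] [IsManifold 𝓘(ℝ, E') ∞ P]

theorem contDiffOn_pullback_cylinder (x : M) {α : Form E' P k} (hα : IsSmoothOn α Set.univ) :
    ContDiffOn ℝ ∞ (pullback (E := E × ℝ) (cylinder s x) α) (chartDomain s x ×ˢ Set.univ) :=
  contDiffOn_pullback ((isOpen_chartDomain s x).prod isOpen_univ) (contMDiffOn_cylinder s hpr x) hα

theorem continuous_fiberVert (hx : x ∈ s.U) {α : Form E' P (k + 1)}
    (hα : IsSmoothOn α Set.univ) : Continuous (fiberVert s α x) := by
  have h1 := continuous_slice (contDiffOn_pullback_cylinder s hpr x hα).continuousOn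
    (extChartAt_mem_chartDomain s hx)
  rw [funext (fiberVert_eq s hpr hx α)]
  exact (ContinuousAlternatingMap.compContinuousLinearMapCLM
    (tangentMapAt (E := E) (E' := E) (extChartAt 𝓘(ℝ, E) x) x)).continuous.comp
      ((vertPart E k).continuous.comp h1)

theorem continuous_fiberHoriz (hx : x ∈ s.U) {α : Form E' P k}
    (hα : IsSmoothOn α Set.univ) : Continuous (fiberHoriz s α x) := by
  have h1 := continuous_slice (contDiffOn_pullback_cylinder s hpr x hα).continuousOn
    (extChartAt_mem_chartDomain s hx)
  rw [funext (fiberHoriz_eq s hpr hx α)]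
  exact (ContinuousAlternatingMap.compContinuousLinearMapCLM
    (tangentMapAt (E := E) (E' := E) (extChartAt 𝓘(ℝ, E) x) x)).continuous.comp
      ((horizPart E k).continuous.comp h1)

theorem continuous_fiberVert_extDer (hx : x ∈ s.U) {α : Form E' P k}
    (hα : IsSmoothOn α Set.univ) : Continuous (fiberVert s (extDer α) x) := by
  have hopen := (isOpen_chartDomain s x).prod (isOpen_univ (X := ℝ))
  have h1 := continuous_slice
    ((contDiffOn_pullback_cylinder s hpr x hα).continuousOn_fderiv_of_isOpen hopen (by simp))
    (extChartAt_mem_chartDomain s hx)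
  rw [funext (fiberVert_eq s hpr hx (extDer α))]
  refine (ContinuousAlternatingMap.compContinuousLinearMapCLM
    (tangentMapAt (E := E) (E' := E) (extChartAt 𝓘(ℝ, E) x) x)).continuous.comp
      ((vertPart E k).continuous.comp ?_)
  refine ((ContinuousAlternatingMap.alternatizeUncurryFinCLM ℝ (E × ℝ) ℂ).continuous.comp
    h1).congr fun t => ?_
  rw [← extDeriv_pullback_eq hopen (contMDiffOn_cylinder s hpr x) hα
    ⟨extChartAt_mem_chartDomain s hx, trivial⟩]
  rfl

theorem chartExpr_fiberIntegralIn (n : ℤ) {α : Form E' P (k + 1)} (hα : IsSmoothOn α Set.univ)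
    {z : E} (hz : z ∈ chartDomain s x) :
    chartExpr x (fiberIntegralIn s n α) z = ∫ t in (0 : ℝ)..1, character n t •
      vertPart E k (pullback (E := E × ℝ) (cylinder s x) α (z, t)) := by
  have hc : Continuous fun t =>
      character n t • fiberVert s α ((extChartAt 𝓘(ℝ, E) x).symm z) t :=
    (contDiff_character n (r := 0)).continuous.smul (continuous_fiberVert s hpr hz.2 hα)
  have h1 := ContinuousLinearMap.intervalIntegral_comp_comm
    (ContinuousAlternatingMap.compContinuousLinearMapCLM (F := ℂ) (ι := Fin k)
      (tangentMapAt (E := E) (E' := E) (extChartAt 𝓘(ℝ, E) x).symm z))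
    (hc.intervalIntegrable (μ := MeasureTheory.volume) 0 1)
  refine h1.symm.trans (intervalIntegral.integral_congr fun t _ => ?_)
  simp only [vertPart_pullback_cylinder s hpr hz]
  rfl

/-- Fibre integrals of smooth forms are smooth. -/
theorem isSmoothOn_fiberIntegralIn (n : ℤ) {α : Form E' P (k + 1)}
    (hα : IsSmoothOn α Set.univ) : IsSmoothOn (fiberIntegralIn s n α) s.U := by
  intro x
  exact (contDiffOn_integral_vertPart n (isOpen_chartDomain s x)
    (contDiffOn_pullback_cylinder s hpr x hα)).congr fun z hz =>
      chartExpr_fiberIntegralIn s hpr n hα hz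

omit [FiniteDimensional ℝ E] [IsManifold 𝓘(ℝ, E') ∞ P] in
theorem horizPart_pullback_cylinder_one (α : Form E' P k) {z : E} (hz : z ∈ chartDomain s x) :
    horizPart E k (pullback (E := E × ℝ) (cylinder s x) α (z, 1)) =
      horizPart E k (pullback (E := E × ℝ) (cylinder s x) α (z, 0)) := by
  rw [horizPart_pullback_cylinder s hpr hz, horizPart_pullback_cylinder s hpr hz]
  simp only [fiberHoriz, rot_one, rot_zero]

theorem integral_fiberHoriz_eq (n : ℤ) (hx : x ∈ s.U) {α : Form E' P k}
    (hα : IsSmoothOn α Set.univ) :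
    ∫ t in (0 : ℝ)..1, character n t • fiberHoriz s α x t =
      (∫ t in (0 : ℝ)..1, character n t • horizPart E k (pullback (E := E × ℝ) (cylinder s x) α
        (extChartAt 𝓘(ℝ, E) x x, t))).compContinuousLinearMap
          (tangentMapAt (E := E) (E' := E) (extChartAt 𝓘(ℝ, E) x) x) := by
  have hc : Continuous fun t => character n t • horizPart E k
      (pullback (E := E × ℝ) (cylinder s x) α (extChartAt 𝓘(ℝ, E) x x, t)) :=
    (contDiff_character n (r := 0)).continuous.smul ((horizPart E k).continuous.comp
      (continuous_slice (contDiffOn_pullback_cylinder s hpr x hα).continuousOn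
        (extChartAt_mem_chartDomain s hx)))
  have h1 := (ContinuousAlternatingMap.compContinuousLinearMapCLM (F := ℂ) (ι := Fin k)
    (tangentMapAt (E := E) (E' := E) (extChartAt 𝓘(ℝ, E) x) x)).intervalIntegral_comp_comm
      (hc.intervalIntegrable (μ := MeasureTheory.volume) 0 1)
  refine Eq.trans (intervalIntegral.integral_congr fun t _ => ?_) h1
  simp only [fiberHoriz_eq s hpr hx]
  rfl

theorem fiberIntegralIn_extDer_eq (n : ℤ) (hx : x ∈ s.U) {α : Form E' P k}
    (hα : IsSmoothOn α Set.univ) :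
    fiberIntegralIn s n (extDer α) x =
      (∫ t in (0 : ℝ)..1, character n t • vertPart E k
        (extDeriv (pullback (E := E × ℝ) (cylinder s x) α)
          (extChartAt 𝓘(ℝ, E) x x, t))).compContinuousLinearMap
            (tangentMapAt (E := E) (E' := E) (extChartAt 𝓘(ℝ, E) x) x) := by
  have hz := extChartAt_mem_chartDomain s hx
  have hopen := (isOpen_chartDomain s x).prod (isOpen_univ (X := ℝ))
  have hc : Continuous fun t => character n t • vertPart E k
      (extDeriv (pullback (E := E × ℝ) (cylinder s x) α) (extChartAt 𝓘(ℝ, E) x x, t)) :=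
    (contDiff_character n (r := 0)).continuous.smul ((vertPart E k).continuous.comp
      ((ContinuousAlternatingMap.alternatizeUncurryFinCLM ℝ (E × ℝ) ℂ).continuous.comp
        (continuous_slice ((contDiffOn_pullback_cylinder s hpr x hα).continuousOn_fderiv_of_isOpen
          hopen (by simp)) hz)))
  have h1 := (ContinuousAlternatingMap.compContinuousLinearMapCLM (F := ℂ) (ι := Fin k)
    (tangentMapAt (E := E) (E' := E) (extChartAt 𝓘(ℝ, E) x) x)).intervalIntegral_comp_comm
      (hc.intervalIntegrable (μ := MeasureTheory.volume) 0 1)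
  refine Eq.trans (intervalIntegral.integral_congr fun t _ => ?_) h1
  change character n t • fiberVert s (extDer α) x t = _
  rw [fiberVert_eq s hpr hx, extDeriv_pullback_eq hopen (contMDiffOn_cylinder s hpr x) hα
    ⟨hz, trivial⟩]
  rfl

/-- Fibre integration anticommutes with the exterior derivative, up to the contribution of the
character. -/
theorem extDer_fiberIntegralIn (n : ℤ) (hx : x ∈ s.U) {α : Form E' P (k + 1)}
    (hα : IsSmoothOn α Set.univ) :
    extDer (fiberIntegralIn s n α) x = -fiberIntegralIn s n (extDer α) x -
      (2 * Real.pi * Complex.I * n) • ∫ t in (0 : ℝ)..1, character n t • fiberHoriz s α x t := by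
  have hz := extChartAt_mem_chartDomain s hx
  have h1 : chartExpr x (fiberIntegralIn s n α) =ᶠ[𝓝 (extChartAt 𝓘(ℝ, E) x x)] fun z =>
      ∫ t in (0 : ℝ)..1, character n t •
        vertPart E k (pullback (E := E × ℝ) (cylinder s x) α (z, t)) := by
    filter_upwards [(isOpen_chartDomain s x).mem_nhds hz] with z hz
      using chartExpr_fiberIntegralIn s hpr n hα hz
  rw [fiberIntegralIn_extDer_eq s hpr n hx hα, integral_fiberHoriz_eq s hpr n hx hα, extDer,
    h1.extDeriv_eq, extDeriv_integral_vertPart n (isOpen_chartDomain s x)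
      (contDiffOn_pullback_cylinder s hpr x hα) hz (horizPart_pullback_cylinder_one s hpr α hz)]
  rfl

/-- The fibre integral of the derivative of a function only sees the character. -/
theorem fiberIntegralIn_extDer_zero (n : ℤ) (hx : x ∈ s.U) {α : Form E' P 0}
    (hα : IsSmoothOn α Set.univ) :
    fiberIntegralIn s n (extDer α) x =
      -((2 * Real.pi * Complex.I * n) •
        ∫ t in (0 : ℝ)..1, character n t • fiberHoriz s α x t) := by
  have hz := extChartAt_mem_chartDomain s hx
  rw [fiberIntegralIn_extDer_eq s hpr n hx hα, integral_fiberHoriz_eq s hpr n hx hα,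
    integral_vertPart_extDeriv_zero n (isOpen_chartDomain s x)
      (contDiffOn_pullback_cylinder s hpr x hα) hz (horizPart_pullback_cylinder_one s hpr α hz)]
  rfl

end Cylinder

/-! ### The `dt`-component of products and contractions -/

section FiberIdentities

theorem zero_wedge {E : Type*} [NormedAddCommGroup E] [NormedSpace ℝ E] {i j k : ℕ}
    (h : i + j = k) (β : E [⋀^Fin j]→L[ℝ] ℂ) : wedge h (0 : E [⋀^Fin i]→L[ℝ] ℂ) β = 0 := by
  ext v
  rw [wedge_apply]
  refine Finset.sum_eq_zero fun σ _ => ?_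
  induction σ using Quotient.inductionOn' with | _ σ
  rw [mul'_summand]
  exact (congrArg _ (zero_mul _)).trans (smul_zero _)

variable {E : Type*} [NormedAddCommGroup E] [NormedSpace ℝ E]
  {M : Type*} [TopologicalSpace M] [ChartedSpace E M]
  {E' : Type*} [NormedAddCommGroup E'] [NormedSpace ℝ E']
  {P : Type*} [TopologicalSpace P] [ChartedSpace E' P] [MulAction Circle P] {pr : P → M}
  (s : LocalSection E E' pr) {x : M} {k : ℕ}

theorem fiberVert_add (α β : Form E' P (k + 1)) (t : ℝ) :
    fiberVert s (α + β) x t = fiberVert s α x t + fiberVert s β x t := rfl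

variable (hpr : IsPrincipalCircleBundle E E' pr)
include hpr

/-- By invariance, the restrictions of a connection form to all rotated sections agree. -/
theorem pullback_rot_of_isConnectionForm {Θ : Form E' P 1} (hΘ : IsConnectionForm Θ)
    (hx : x ∈ s.U) (t : ℝ) :
    pullback (E := E) (fun y => rot t (s.toFun y)) Θ x = pullback s.toFun Θ x := by
  rw [pullback_comp (g := fun p : P => rot t p) (f := s.toFun) Θ
    ((hpr.contMDiff_rot_right t).mdifferentiableAt (by simp))
    ((s.contMDiffAt hx).mdifferentiableAt (by simp))]
  have h1 : pullback (E := E') (fun p : P => rot t p) Θ = Θ := hΘ.invariant _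
  rw [h1]
  rfl

/-- The `dt`-component of `Θ ∧ (dt ∧ β + γ)` is `2πi γ - s^*Θ ∧ β`. -/
theorem fiberVert_oneWedge_succ {Θ : Form E' P 1} (hΘ : IsConnectionForm Θ) (hx : x ∈ s.U)
    (w : TotalForm E' P) (t : ℝ) :
    fiberVert s (oneWedge Θ w (k + 1 + 1)) x t =
      (2 * Real.pi * Complex.I : ℂ) • fiberHoriz s (w (k + 1)) x t -
        wedge (Nat.add_comm 1 k) (pullback s.toFun Θ x) (fiberVert s (w (k + 1)) x t) := by
  rw [fiberVert, oneWedge, contract_one_wedge _ (Nat.add_comm 1 k), hΘ.vert,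
    ← pullback_rot_of_isConnectionForm s hpr hΘ hx t, fiberVert, pullback,
    ← wedge_compContinuousLinearMap]
  rfl

omit hpr in
theorem fiberVert_oneWedge_zero {Θ : Form E' P 1} (hΘ : IsConnectionForm Θ)
    (w : TotalForm E' P) (t : ℝ) :
    fiberVert s (oneWedge Θ w (0 + 1)) x t =
      (2 * Real.pi * Complex.I : ℂ) • fiberHoriz s (w 0) x t := by
  rw [fiberVert, oneWedge, contract_one_wedge_zero, hΘ.vert]
  rfl

/-- The `dt`-component of `ι_{Y'} w` is `-ι_Y β`: the contractions with `Y'` and `∂/∂t` anticommute,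
and the vertical part of `Y'` does not contribute. -/
theorem fiberVert_contract {Y : M → E} {Y' : P → E'}
    (hlift : ∀ p : P, tangentMapAt pr p (Y' p) = Y (pr p)) (hx : x ∈ s.U)
    (w : TotalForm E' P) (t : ℝ) :
    fiberVert s (w.contract Y' (k + 1)) x t =
      -contract (Y x) (fiberVert s (w (k + 1 + 1)) x t) := by
  set p := rot t (s.toFun x) with hp
  set l := tangentMapAt (E := E) (E' := E') (fun y => rot t (s.toFun y)) x with hl
  set β := contract (vert p) (w (k + 1 + 1) p) with hβ
  obtain ⟨c, hc⟩ := hpr.exists_eq_smul_vert p (Y' p - l (Y x)) (by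
    have h1 := congrArg (fun L : E →L[ℝ] E => L (Y x)) (s.tangentMapAt_proj_rot hpr t hx)
    have h2 : tangentMapAt (E := E') (E' := E) pr p (l (Y x)) = Y x := h1
    rw [map_sub, hlift, h2, hp, hpr.proj_rot, s.proj x hx, sub_self])
  ext v
  have h3 : fiberVert s (w.contract Y' (k + 1)) x t v =
      w (k + 1 + 1) p (Fin.cons (Y' p) (Fin.cons (vert p) fun a => l (v a))) := rfl
  have h4 : (-contract (Y x) (fiberVert s (w (k + 1 + 1)) x t)) v =
      -β (Fin.cons (l (Y x)) fun a => l (v a)) := by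
    refine congrArg Neg.neg ?_
    change w (k + 1 + 1) p (Fin.cons (vert p) fun a => l ((Fin.cons (Y x) v : Fin (k + 1) → E) a)) =
      w (k + 1 + 1) p (Fin.cons (vert p) (Fin.cons (l (Y x)) fun a => l (v a)))
    congr 2
    funext a
    refine Fin.cases ?_ (fun a => ?_) a <;> simp
  have h5 : w (k + 1 + 1) p (Fin.cons (Y' p) (Fin.cons (vert p) fun a => l (v a))) =
      -β (Fin.cons (Y' p) fun a => l (v a)) := by
    have h6 := (w (k + 1 + 1) p).map_swap
      (Fin.cons (vert p) (Fin.cons (Y' p) fun a => l (v a))) (i := 0) (j := 1) (by simp)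
    refine Eq.trans (congrArg (w (k + 1 + 1) p) ?_) h6
    funext a
    refine Fin.cases ?_ (fun a => ?_) a
    · simp
    · refine Fin.cases ?_ (fun a => ?_) a
      · simp
      · rw [Function.comp_apply, Equiv.swap_apply_of_ne_of_ne (Fin.succ_ne_zero _)
          (by simp [Fin.ext_iff])]
        simp
  have h7 : β.curryLeft (Y' p) = β.curryLeft (l (Y x)) := by
    rw [← sub_eq_zero, ← map_sub, hc, map_smul]
    have h8 : β.curryLeft (vert p) = 0 := by
      ext m
      exact contract_eq_zero_of_eq (w (k + 1 + 1) p) (vert p) (Fin.cons (vert p) m) ⟨0, rfl⟩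
    rw [h8, smul_zero]
  rw [h3, h4, h5]
  exact congrArg (fun δ : E' [⋀^Fin k]→L[ℝ] ℂ => -δ fun a => l (v a)) h7

omit s in
/-- Forms pulled back from the base are annihilated by `∂/∂t`. -/
theorem pullback_proj_eq_zero_of_eq_vert {i : ℕ} (η : Form E M i) (p : P) (v : Fin i → E')
    (hv : ∃ a, v a = vert p) : pullback (E := E') pr η p v = 0 := by
  obtain ⟨a, ha⟩ := hv
  refine (η _).map_coord_zero a ?_
  change tangentMapAt (E := E') (E' := E) pr p (v a) = 0
  rw [ha, hpr.tangentMapAt_proj_vert]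

/-- The wedge product with a form pulled back from the base, up to sign, commutes with taking the
`dt`-component. -/
theorem fiberVert_pullback_wedge {i j : ℕ} (h : i + (j + 1) = k + 1) (h' : i + j = k)
    (hx : x ∈ s.U) (η : Form E M i) (α : Form E' P (j + 1)) (t : ℝ) :
    fiberVert s (fun p => wedge h (pullback (E := E') pr η p) (α p)) x t =
      (-1 : ℂ) ^ i • wedge h' (η x) (fiberVert s α x t) := by
  rw [fiberVert, contract_wedge_of_forall_eq_zero h h' _ _ _
    (pullback_proj_eq_zero_of_eq_vert hpr η _)]
  have h1 : (pullback (E := E') pr η (rot t (s.toFun x))).compContinuousLinearMap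
      (tangentMapAt (E := E) (E' := E') (fun y => rot t (s.toFun y)) x) = η x := by
    have h2 := s.tangentMapAt_proj_rot hpr t hx
    ext v
    change η (pr (rot t (s.toFun x))) (fun a =>
      ((tangentMapAt (E := E') (E' := E) pr (rot t (s.toFun x))).comp
      (tangentMapAt (E := E) (E' := E') (fun y => rot t (s.toFun y)) x)) (v a)) = η x v
    rw [h2, hpr.proj_rot, s.proj x hx]
    rfl
  have h3 := wedge_compContinuousLinearMap h' (pullback (E := E') pr η (rot t (s.toFun x)))
    (contract (vert (rot t (s.toFun x))) (α (rot t (s.toFun x))))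
    (tangentMapAt (E := E) (E' := E') (fun y => rot t (s.toFun y)) x)
  rw [h1] at h3
  exact congrArg (fun δ => (-1 : ℂ) ^ i • δ) h3

theorem fiberVert_pullback_wedge_zero {i : ℕ} (h : i + 0 = k + 1) (η : Form E M i)
    (α : Form E' P 0) (t : ℝ) :
    fiberVert s (fun p => wedge h (pullback (E := E') pr η p) (α p)) x t = 0 := by
  rw [fiberVert, contract_wedge_zero_of_forall_eq_zero h _ _ _
    (pullback_proj_eq_zero_of_eq_vert hpr η _)]
  rfl

/-- The `dt`-component of the product with an odd form pulled back from the base. -/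
theorem fiberVert_wedge (hx : x ∈ s.U) (H : TotalForm E M) (hodd : ∀ k, Even k → H k = 0)
    (w : TotalForm E' P) (t : ℝ) :
    fiberVert s ((H.pullback pr).wedge w (k + 1)) x t =
      -TotalForm.wedge H (fun j x => fiberVert s (w (j + 1)) x t) k x := by
  have hterm {i j j' : ℕ} (hj : j = j' + 1) (h : i + j = k + 1) (h' : i + j' = k) :
      fiberVert s (fun p => wedge h (H.pullback pr i p) (w j p)) x t =
        -wedge h' (H i x) (fiberVert s (w (j' + 1)) x t) := by
    subst hj
    refine (fiberVert_pullback_wedge s hpr h h' hx (H i) (w (j' + 1)) t).trans ?_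
    ext v
    change (-1 : ℂ) ^ i * wedge h' (H i x) (fiberVert s (w (j' + 1)) x t) v =
      -(wedge h' (H i x) (fiberVert s (w (j' + 1)) x t) v)
    rcases Nat.even_or_odd i with hi | hi
    · rw [hodd i hi]
      change (-1 : ℂ) ^ i * wedge h' 0 _ v = -(wedge h' 0 _ v)
      rw [zero_wedge]
      simp
    · rw [hi.neg_one_pow, neg_one_mul]
  have hterm0 {i j : ℕ} (hj : j = 0) (h : i + j = k + 1) :
      fiberVert s (fun p => wedge h (H.pullback pr i p) (w j p)) x t = 0 := by
    subst hj
    exact fiberVert_pullback_wedge_zero s hpr h (H i) (w 0) t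
  have hsum : fiberVert s ((H.pullback pr).wedge w (k + 1)) x t = ∑ i : Fin (k + 1 + 1),
      fiberVert s (fun p => wedge (Nat.add_sub_of_le (Nat.le_of_lt_succ i.2))
        (H.pullback pr i p) (w (k + 1 - i) p)) x t := by
    ext v
    rw [ContinuousAlternatingMap.sum_apply]
    exact ContinuousAlternatingMap.sum_apply (fun i : Fin (k + 1 + 1) =>
      wedge (Nat.add_sub_of_le (Nat.le_of_lt_succ i.2)) (H.pullback pr i (rot t (s.toFun x)))
        (w (k + 1 - i) (rot t (s.toFun x)))) _
  rw [hsum, Fin.sum_univ_castSucc, hterm0 (by simp), add_zero, TotalForm.wedge,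
    ← Finset.sum_neg_distrib]
  refine Finset.sum_congr rfl fun i _ => ?_
  exact hterm (Nat.sub_add_comm (Nat.le_of_lt_succ i.2)) _ _

end FiberIdentities

/-! ### The identity for the coefficient forms, and local frames -/

section Integrated

variable {E : Type*} [NormedAddCommGroup E] [NormedSpace ℝ E] [FiniteDimensional ℝ E] {i k : ℕ}

/-- Complex linear operations on forms commute with twisted integration over the circle. -/
theorem integral_character_smul_map (n : ℤ)
    (T : (E [⋀^Fin i]→L[ℝ] ℂ) →ₗ[ℂ] (E [⋀^Fin k]→L[ℝ] ℂ)) {f : ℝ → E [⋀^Fin i]→L[ℝ] ℂ}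
    (hf : Continuous f) :
    ∫ t in (0 : ℝ)..1, character n t • T (f t) = T (∫ t in (0 : ℝ)..1, character n t • f t) := by
  have hc : Continuous fun t => character n t • f t :=
    (contDiff_character n (r := 0)).continuous.smul hf
  have h1 := (LinearMap.toContinuousLinearMap (T.restrictScalars ℝ)).intervalIntegral_comp_comm
    (hc.intervalIntegrable (μ := MeasureTheory.volume) 0 1)
  refine Eq.trans (intervalIntegral.integral_congr fun t _ => ?_) h1
  exact (T.map_smul _ _).symm

theorem continuous_map_of_linear (T : (E [⋀^Fin i]→L[ℝ] ℂ) →ₗ[ℂ] (E [⋀^Fin k]→L[ℝ] ℂ))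
    {f : ℝ → E [⋀^Fin i]→L[ℝ] ℂ} (hf : Continuous f) : Continuous fun t => T (f t) :=
  (LinearMap.toContinuousLinearMap (T.restrictScalars ℝ)).continuous.comp hf

omit [FiniteDimensional ℝ E] in
theorem continuous_const_smul_form {f : ℝ → E [⋀^Fin k]→L[ℝ] ℂ} (c : ℂ) (hf : Continuous f) :
    Continuous fun t => c • f t :=
  hf.const_smul c

omit [FiniteDimensional ℝ E] in
theorem continuous_sub_form {f g : ℝ → E [⋀^Fin k]→L[ℝ] ℂ} (hf : Continuous f)
    (hg : Continuous g) : Continuous fun t => f t - g t :=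
  hf.sub hg

omit [FiniteDimensional ℝ E] in
theorem integral_character_smul_add (n : ℤ) {f g : ℝ → E [⋀^Fin k]→L[ℝ] ℂ}
    (hf : Continuous f) (hg : Continuous g) :
    ∫ t in (0 : ℝ)..1, character n t • (f t + g t) =
      (∫ t in (0 : ℝ)..1, character n t • f t) + ∫ t in (0 : ℝ)..1, character n t • g t := by
  have hχ : Continuous (character n) := (contDiff_character n (r := 0)).continuous
  simp only [smul_add]
  exact intervalIntegral.integral_add ((hχ.smul hf).intervalIntegrable _ _)
    ((hχ.smul hg).intervalIntegrable _ _)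

omit [FiniteDimensional ℝ E] in
theorem integral_character_smul_sub (n : ℤ) {f g : ℝ → E [⋀^Fin k]→L[ℝ] ℂ}
    (hf : Continuous f) (hg : Continuous g) :
    ∫ t in (0 : ℝ)..1, character n t • (f t - g t) =
      (∫ t in (0 : ℝ)..1, character n t • f t) - ∫ t in (0 : ℝ)..1, character n t • g t := by
  have hχ : Continuous (character n) := (contDiff_character n (r := 0)).continuous
  simp only [smul_sub]
  exact intervalIntegral.integral_sub ((hχ.smul hf).intervalIntegrable _ _)
    ((hχ.smul hg).intervalIntegrable _ _)

omit [FiniteDimensional ℝ E] in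
theorem integral_character_smul_smul (n : ℤ) (c : ℂ) (f : ℝ → E [⋀^Fin k]→L[ℝ] ℂ) :
    ∫ t in (0 : ℝ)..1, character n t • c • f t =
      c • ∫ t in (0 : ℝ)..1, character n t • f t := by
  simp only [smul_comm _ c]
  exact intervalIntegral.integral_smul _ _

variable {M : Type*} [TopologicalSpace M] [ChartedSpace E M] [IsManifold 𝓘(ℝ, E) ∞ M]
  {E' : Type*} [NormedAddCommGroup E'] [NormedSpace ℝ E']
  {P : Type*} [TopologicalSpace P] [ChartedSpace E' P] [IsManifold 𝓘(ℝ, E') ∞ P]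
  [MulAction Circle P] {pr : P → M} (s : LocalSection E E' pr) {x : M}
  (hpr : IsPrincipalCircleBundle E E' pr)

/-- The coefficient form of the twisted fibre integral in the frame given by `s`. -/
noncomputable def fiberCoeff (n : ℤ) (w : TotalForm E' P) : TotalForm E M :=
  fun k => fiberIntegralIn s n (w (k + 1))

include hpr

theorem continuous_fiberVert_d (hx : x ∈ s.U) {w : TotalForm E' P} (hw : w.IsSmooth) :
    Continuous (fiberVert s (w.d (k + 1)) x) :=
  continuous_fiberVert_extDer s hpr hx (hw k)

theorem continuous_fiberVert_oneWedge {Θ : Form E' P 1} (hΘ : IsConnectionForm Θ) (hx : x ∈ s.U)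
    {w : TotalForm E' P} (hw : w.IsSmooth) :
    Continuous (fiberVert s (oneWedge Θ w (k + 1)) x) := by
  cases k with
  | zero =>
    rw [funext (fiberVert_oneWedge_zero s hΘ w)]
    exact continuous_const_smul_form _ (continuous_fiberHoriz s hpr hx (hw 0))
  | succ k =>
    rw [funext (fiberVert_oneWedge_succ s hpr hΘ hx w)]
    exact continuous_sub_form
      (continuous_const_smul_form _ (continuous_fiberHoriz s hpr hx (hw (k + 1))))
      (continuous_map_of_linear (wedgeLeft (Nat.add_comm 1 k) (pullback s.toFun Θ x))
        (continuous_fiberVert s hpr hx (hw (k + 1))))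

theorem continuous_fiberVert_contract {Y : M → E} {Y' : P → E'}
    (hlift : ∀ p : P, tangentMapAt pr p (Y' p) = Y (pr p)) (hx : x ∈ s.U)
    {w : TotalForm E' P} (hw : w.IsSmooth) :
    Continuous (fiberVert s (w.contract Y' (k + 1)) x) := by
  rw [funext (fiberVert_contract s hpr hlift hx w)]
  exact (continuous_map_of_linear (contract (Y x)) (continuous_fiberVert s hpr hx (hw _))).neg

theorem continuous_fiberVert_wedge (hx : x ∈ s.U) {H : TotalForm E M}
    (hodd : ∀ k, Even k → H k = 0) {w : TotalForm E' P} (hw : w.IsSmooth) :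
    Continuous (fiberVert s ((H.pullback pr).wedge w (k + 1)) x) := by
  rw [funext (fiberVert_wedge s hpr hx H hodd w)]
  refine (continuous_finsetSum _ fun i _ => ?_).neg
  exact continuous_map_of_linear (wedgeLeft _ _) (continuous_fiberVert s hpr hx (hw _))

/-- In a local frame, the twisted fibre integral intertwines the covariant derivative with
`-(d + nΘ)`. -/
theorem d_fiberCoeff_add {Θ : Form E' P 1} (hΘ : IsConnectionForm Θ) (hx : x ∈ s.U) (n : ℤ)
    {w : TotalForm E' P} (hw : w.IsSmooth) (k : ℕ) :
    (fiberCoeff s n w).d k x + (n : ℂ) • oneWedge (pullback s.toFun Θ) (fiberCoeff s n w) k x =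
      -fiberCoeff s n (w.d + (n : ℂ) • oneWedge Θ w) k x := by
  have h1 : fiberCoeff s n (w.d + (n : ℂ) • oneWedge Θ w) k x =
      fiberIntegralIn s n (extDer (w k)) x + (n : ℂ) • ∫ t in (0 : ℝ)..1, character n t •
        fiberVert s (oneWedge Θ w (k + 1)) x t := by
    rw [← integral_character_smul_smul]
    have h2 := integral_character_smul_add n (continuous_fiberVert_extDer s hpr hx (hw k))
      (continuous_const_smul_form (n : ℂ) (continuous_fiberVert_oneWedge s hpr hΘ hx hw))
    refine Eq.trans (intervalIntegral.integral_congr fun t _ => ?_) h2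
    exact congrArg (fun β => character n t • β)
      (fiberVert_add s (extDer (w k)) ((n : ℂ) • oneWedge Θ w (k + 1)) t)
  rw [h1]
  cases k with
  | zero =>
    simp only [fiberVert_oneWedge_zero s hΘ w, integral_character_smul_smul]
    rw [fiberIntegralIn_extDer_zero s hpr n hx (hw 0), smul_smul, mul_comm (n : ℂ),
      neg_add_cancel, neg_zero]
    change (0 : E [⋀^Fin 0]→L[ℝ] ℂ) + (n : ℂ) • (0 : E [⋀^Fin 0]→L[ℝ] ℂ) = 0
    exact (congrArg _ (smul_zero (n : ℂ))).trans (add_zero _)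
  | succ k =>
    simp only [fiberVert_oneWedge_succ s hpr hΘ hx w]
    have h5 := integral_character_smul_sub n
      (continuous_const_smul_form (2 * Real.pi * Complex.I : ℂ)
        (continuous_fiberHoriz s hpr hx (hw (k + 1))))
      (continuous_map_of_linear (wedgeLeft (Nat.add_comm 1 k) (pullback s.toFun Θ x))
        (continuous_fiberVert s hpr hx (hw (k + 1))))
    rw [integral_character_smul_smul] at h5
    refine Eq.trans ?_ (congrArg (fun I => -(fiberIntegralIn s n (extDer (w (k + 1))) x +
      (n : ℂ) • I)) h5.symm)
    have h2 := integral_character_smul_map n (wedgeLeft (Nat.add_comm 1 k) (pullback s.toFun Θ x))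
      (continuous_fiberVert s hpr hx (hw (k + 1)))
    have h3 : (fiberCoeff s n w).d (k + 1) x = _ := extDer_fiberIntegralIn s hpr n hx (hw (k + 1))
    have h4 : oneWedge (pullback s.toFun Θ) (fiberCoeff s n w) (k + 1) x =
      ∫ t in (0 : ℝ)..1, character n t • wedge (Nat.add_comm 1 k) (pullback s.toFun Θ x)
        (fiberVert s (w (k + 1)) x t) := h2.symm
    rw [h3, h4, smul_sub, smul_smul, mul_comm (n : ℂ)]
    change _ = -(_ + (_ - (n : ℂ) • ∫ t in (0 : ℝ)..1, character n t •
      wedge (Nat.add_comm 1 k) (pullback s.toFun Θ x) (fiberVert s (w (k + 1)) x t)))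
    abel

theorem fiberCoeff_contract {Y : M → E} {Y' : P → E'}
    (hlift : ∀ p : P, tangentMapAt pr p (Y' p) = Y (pr p)) (hx : x ∈ s.U) (n : ℤ)
    {w : TotalForm E' P} (hw : w.IsSmooth) (k : ℕ) :
    fiberCoeff s n (w.contract Y') k x = -contract (Y x) (fiberCoeff s n w (k + 1) x) := by
  have h1 := integral_character_smul_map n (-contract (Y x))
    (continuous_fiberVert s hpr hx (hw (k + 1 + 1)))
  refine Eq.trans (intervalIntegral.integral_congr fun t _ => ?_) h1
  exact congrArg _ (fiberVert_contract s hpr hlift hx w t)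

theorem fiberCoeff_wedge (hx : x ∈ s.U) {H : TotalForm E M}
    (hodd : ∀ k, Even k → H k = 0) (n : ℤ) {w : TotalForm E' P} (hw : w.IsSmooth) (k : ℕ) :
    fiberCoeff s n ((H.pullback pr).wedge w) k x = -H.wedge (fiberCoeff s n w) k x := by
  have h1 : fiberCoeff s n ((H.pullback pr).wedge w) k x = ∫ t in (0 : ℝ)..1, character n t •
      -TotalForm.wedge H (fun j x => fiberVert s (w (j + 1)) x t) k x :=
    intervalIntegral.integral_congr fun t _ => congrArg _ (fiberVert_wedge s hpr hx H hodd w t)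
  have hχ : Continuous (character n) := (contDiff_character n (r := 0)).continuous
  rw [h1]
  simp only [smul_neg, TotalForm.wedge, Finset.smul_sum]
  rw [intervalIntegral.integral_neg, intervalIntegral.integral_finsetSum]
  · refine congrArg _ (Finset.sum_congr rfl fun i _ => ?_)
    exact integral_character_smul_map n (wedgeLeft _ (H i x))
      (continuous_fiberVert s hpr hx (hw (k - i + 1)))
  · exact fun i _ => (hχ.smul (continuous_map_of_linear (wedgeLeft _ _)
      (continuous_fiberVert s hpr hx (hw _)))).intervalIntegrable _ _

/-- The identity of the theorem for the coefficient forms in a local frame. -/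
theorem fiberCoeff_identity {Θ : Form E' P 1} (hΘ : IsConnectionForm Θ) {Y : M → E} {Y' : P → E'}
    (hlift : ∀ p : P, tangentMapAt pr p (Y' p) = Y (pr p)) {H : TotalForm E M}
    (hodd : ∀ k, Even k → H k = 0) (hx : x ∈ s.U) (n : ℤ) {w : TotalForm E' P}
    (hw : w.IsSmooth) (k : ℕ) :
    (fiberCoeff s n w).d k x + (n : ℂ) • oneWedge (pullback s.toFun Θ) (fiberCoeff s n w) k x
        - contract (Y x) (fiberCoeff s n w (k + 1) x) + H.wedge (fiberCoeff s n w) k x =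
      -fiberCoeff s n (w.d + (n : ℂ) • oneWedge Θ w - w.contract Y' +
        (H.pullback pr).wedge w) k x := by
  have hc1 : Continuous (fiberVert s ((w.d + (n : ℂ) • oneWedge Θ w) (k + 1)) x) :=
    (continuous_fiberVert_d s hpr hx hw).add
      ((continuous_fiberVert_oneWedge s hpr hΘ hx hw).const_smul (n : ℂ))
  have hc2 := continuous_fiberVert_contract s hpr hlift hx hw (k := k)
  have hc3 := continuous_fiberVert_wedge s hpr hx hodd hw (k := k)
  have h1 : fiberCoeff s n (w.d + (n : ℂ) • oneWedge Θ w - w.contract Y' +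
      (H.pullback pr).wedge w) k x = fiberCoeff s n (w.d + (n : ℂ) • oneWedge Θ w) k x -
        fiberCoeff s n (w.contract Y') k x + fiberCoeff s n ((H.pullback pr).wedge w) k x := by
    refine (integral_character_smul_add n (continuous_sub_form hc1 hc2) hc3).trans ?_
    rw [integral_character_smul_sub n hc1 hc2]
    rfl
  rw [h1, d_fiberCoeff_add s hpr hΘ hx n hw, fiberCoeff_contract s hpr hlift hx n hw,
    fiberCoeff_wedge s hpr hx hodd n hw]
  abel

end Integrated

section Frames

theorem tpow_smul {V : Type*} [NormedAddCommGroup V] [InnerProductSpace ℂ V] (u : Circle) (v : V)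
    (n : ℤ) : tpow ((u : ℂ) • v) n = ((u : ℂ) ^ n) • tpow v n := by
  cases n with
  | ofNat n =>
    have h1 := (PiTensorProduct.tprod ℂ (s := fun _ : Fin n => V)).map_smul_univ
      (fun _ => (u : ℂ)) (fun _ => v)
    refine h1.trans ?_
    rw [Finset.prod_const, Finset.card_univ, Fintype.card_fin]
    change _ = ((u : ℂ) ^ (n : ℤ)) • _
    rw [zpow_natCast]
    rfl
  | negSucc n =>
    have h0 : dualVec ((u : ℂ) • v) = (u : ℂ)⁻¹ • dualVec v := by
      ext y
      simp [dualVec, ← Circle.coe_inv_eq_conj]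
    have h1 := (PiTensorProduct.tprod ℂ (s := fun _ : Fin (n + 1) => Module.Dual ℂ V)).map_smul_univ
      (fun _ => (u : ℂ)⁻¹) (fun _ => dualVec v)
    change PiTensorProduct.tprod ℂ (fun _ : Fin (n + 1) => dualVec ((u : ℂ) • v)) = _
    rw [h0]
    refine h1.trans ?_
    rw [Finset.prod_const, Finset.card_univ, Fintype.card_fin, zpow_negSucc, inv_pow]
    rfl

theorem exp_zpow_eq_character (n : ℤ) (τ : ℝ) :
    ((Circle.exp (2 * Real.pi * τ) : Circle) : ℂ) ^ n = character n τ := by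
  rw [Circle.coe_exp, ← Complex.exp_int_mul, character]
  push_cast
  ring_nf

variable {E : Type*} [NormedAddCommGroup E] [NormedSpace ℝ E]
  {M : Type*} [TopologicalSpace M] [ChartedSpace E M]
  {E' : Type*} [NormedAddCommGroup E'] [NormedSpace ℝ E']
  {P : Type*} [TopologicalSpace P] [ChartedSpace E' P] [MulAction Circle P] {pr : P → M}
  {L : M → Type*} [∀ x, NormedAddCommGroup (L x)] [∀ x, InnerProductSpace ℂ (L x)]
  [TopologicalSpace (TotalSpace ℂ L)] [FiberBundle ℂ L]
  (j : CircleBundleIso E E' L pr) (s s' : LocalSection E E' pr) {x : M}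

theorem CircleBundleIso.mk_frame (hx : x ∈ s.U) :
    (⟨x, j.frame s x⟩ : TotalSpace ℂ L) = ⟨pr (s.toFun x), j.vec (s.toFun x)⟩ := by
  have h (y : M) (hy : y = x) (v : L y) : (⟨x, hy ▸ v⟩ : TotalSpace ℂ L) = ⟨y, v⟩ := by
    subst hy
    rfl
  rw [CircleBundleIso.frame, dif_pos (s.proj x hx)]
  exact h _ _ _

theorem CircleBundleIso.norm_frame (hx : x ∈ s.U) : ‖j.frame s x‖ = 1 :=
  (congrArg (fun q : TotalSpace ℂ L => ‖q.2‖) (j.mk_frame s hx)).trans (j.norm_vec _)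

theorem CircleBundleIso.frame_of_eq_smul (hx : x ∈ s.U) (hx' : x ∈ s'.U) {u : Circle}
    (hu : s'.toFun x = u • s.toFun x) : j.frame s' x = (u : ℂ) • j.frame s x := by
  have h1 := j.mk_frame s' hx'
  rw [hu, j.vec_smul] at h1
  have h2 := congrArg (fun q : TotalSpace ℂ L => (⟨q.1, (u : ℂ) • q.2⟩ : TotalSpace ℂ L))
    (j.mk_frame s hx)
  have h3 := h1.trans h2.symm
  simpa using h3

/-- The twisted fibre integral does not depend on the choice of the local section: under a rotation
of the section by the angle `τ`, the coefficient is multiplied by `e^{-2πinτ}` and the frame of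
`L^{⊗n}` by `e^{2πinτ}`. -/
theorem twistedIntegralIn_eq (hpr : IsPrincipalCircleBundle E E' pr) (hx : x ∈ s.U)
    (hx' : x ∈ s'.U) (n : ℤ) (w : TotalForm E' P) (k : ℕ) :
    twistedIntegralIn j n s' w k x = twistedIntegralIn j n s w k x := by
  obtain ⟨τ, hτ⟩ := hpr.exists_eq_rot ((s.proj x hx).trans (s'.proj x hx').symm)
  rw [twistedIntegralIn, twistedIntegralIn, fiberIntegralIn_of_eq_rot s s' hpr hx hx' hτ,
    j.frame_of_eq_smul s s' hx hx' hτ, tpow_smul, exp_zpow_eq_character, TensorProduct.tmul_smul,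
    ← TensorProduct.smul_tmul', smul_smul, ← character_add, add_neg_cancel, character_zero,
    one_smul]

theorem IsPrincipalCircleBundle.mem_localSection (hpr : IsPrincipalCircleBundle E E' pr) (x : M) :
    x ∈ (hpr.localSection x).U := (hpr.exists_localSection x).choose_spec

theorem twistedIntegral_eq (hpr : IsPrincipalCircleBundle E E' pr) (hx : x ∈ s.U) (n : ℤ)
    (w : TotalForm E' P) (k : ℕ) :
    twistedIntegral hpr j n w k x = twistedIntegralIn j n s w k x :=
  twistedIntegralIn_eq j s (hpr.localSection x) hpr hx (hpr.mem_localSection x) n w k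

theorem coeffForm_twistedIntegral (hpr : IsPrincipalCircleBundle E E' pr) (hx : x ∈ s.U) (n : ℤ)
    (w : TotalForm E' P) (k : ℕ) :
    coeffForm j s (twistedIntegral hpr j n w) k x = fiberCoeff s n w k x := by
  rw [coeffForm, twistedIntegral_eq j s hpr hx, twistedIntegralIn, LinearMap.lTensor_tmul,
    tcoord_tpow _ (j.norm_frame s hx), TensorProduct.rid_tmul, one_smul]
  rfl

end Frames

/-! ### Forms with values in the tensor powers of the line bundle -/

section Covariant

variable {E : Type*} [NormedAddCommGroup E] [NormedSpace ℝ E] [FiniteDimensional ℝ E]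
  {M : Type*} [TopologicalSpace M] [ChartedSpace E M] [IsManifold 𝓘(ℝ, E) ∞ M]
  {E' : Type*} [NormedAddCommGroup E'] [NormedSpace ℝ E']
  {P : Type*} [TopologicalSpace P] [ChartedSpace E' P] [IsManifold 𝓘(ℝ, E') ∞ P]
  [MulAction Circle P] {pr : P → M}
  {L : M → Type*} [∀ x, NormedAddCommGroup (L x)] [∀ x, InnerProductSpace ℂ (L x)]
  [TopologicalSpace (TotalSpace ℂ L)] [FiberBundle ℂ L]
  (j : CircleBundleIso E E' L pr) (s : LocalSection E E' pr) {x : M}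
  (hpr : IsPrincipalCircleBundle E E' pr)

omit [FiniteDimensional ℝ E] [IsManifold 𝓘(ℝ, E) ∞ M]
  [IsManifold 𝓘(ℝ, E') ∞ P] in
theorem covDerIn_twistedIntegral (hx : x ∈ s.U) (Θ : Form E' P 1) (n : ℤ) (w : TotalForm E' P)
    (k : ℕ) :
    covDerIn j Θ s (twistedIntegral hpr j n w) k x =
      ((fiberCoeff s n w).d k x +
        (n : ℂ) • oneWedge (pullback s.toFun Θ) (fiberCoeff s n w) k x) ⊗ₜ
          tpow (j.frame s x) n := by
  cases k with
  | zero => rfl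
  | succ k =>
    -- The exterior derivative depends only on the germ, and the coefficients agree on `s.U`.
    have h1 : (coeffForm j s (twistedIntegral hpr j n w)).d (k + 1) x =
        (fiberCoeff s n w).d (k + 1) x :=
      extDer_congr (Filter.eventuallyEq_of_mem (s.isOpen.mem_nhds hx)
        fun y hy => coeffForm_twistedIntegral j s hpr hy n w k)
    have h2 : oneWedge (pullback s.toFun Θ) (coeffForm j s (twistedIntegral hpr j n w)) (k + 1) x =
        oneWedge (pullback s.toFun Θ) (fiberCoeff s n w) (k + 1) x :=
      congrArg (wedge (Nat.add_comm 1 k) (pullback s.toFun Θ x))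
        (coeffForm_twistedIntegral j s hpr hx n w k)
    rw [covDerIn, h1, h2]

/-- The twisted fibre integral intertwines `∇` with `-(d + nΘ)`; as the right-hand side does not
depend on the local section, neither does the local expression of `∇`. -/
theorem covDerIn_twistedIntegral_eq_neg {Θ : Form E' P 1} (hΘ : IsConnectionForm Θ) (hx : x ∈ s.U)
    (n : ℤ) {w : TotalForm E' P} (hw : w.IsSmooth) (k : ℕ) :
    covDerIn j Θ s (twistedIntegral hpr j n w) k x =
      -twistedIntegral hpr j n (w.d + (n : ℂ) • oneWedge Θ w) k x := by
  rw [covDerIn_twistedIntegral j s hpr hx, d_fiberCoeff_add s hpr hΘ hx n hw,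
    TensorProduct.neg_tmul, twistedIntegral_eq j s hpr hx]
  rfl

theorem isSmooth_twistedIntegral (n : ℤ) {w : TotalForm E' P} (hw : w.IsSmooth) :
    LForm.IsSmooth j (twistedIntegral hpr j n w) := fun s k =>
  (isSmoothOn_fiberIntegralIn s hpr n (hw (k + 1))).congr fun _ hx =>
    coeffForm_twistedIntegral j s hpr hx n w k

theorem covDer_sub_contract_add_wedge_twistedIntegral {Θ : Form E' P 1} (hΘ : IsConnectionForm Θ)
    {Y : M → E} {Y' : P → E'} (hlift : ∀ p : P, tangentMapAt pr p (Y' p) = Y (pr p))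
    {H : TotalForm E M} (hodd : ∀ k, Even k → H k = 0) (n : ℤ) {w : TotalForm E' P}
    (hw : w.IsSmooth) :
    covDer hpr j Θ (twistedIntegral hpr j n w)
        - LForm.contract Y (twistedIntegral hpr j n w)
        + LForm.wedge H (twistedIntegral hpr j n w)
      = -twistedIntegral hpr j n
          (w.d + (n : ℂ) • oneWedge Θ w - w.contract Y' + (H.pullback pr).wedge w) := by
  funext k x
  have hx := hpr.mem_localSection x
  set s := hpr.localSection x with hs
  have h1 : covDer hpr j Θ (twistedIntegral hpr j n w) k x =
      ((fiberCoeff s n w).d k x +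
        (n : ℂ) • oneWedge (pullback s.toFun Θ) (fiberCoeff s n w) k x) ⊗ₜ
          tpow (j.frame s x) n :=
    covDerIn_twistedIntegral j s hpr hx Θ n w k
  have h2 : LForm.contract Y (twistedIntegral hpr j n w) k x =
      contract (Y x) (fiberCoeff s n w (k + 1) x) ⊗ₜ tpow (j.frame s x) n :=
    LinearMap.rTensor_tmul _ _ _ _
  have h3 : LForm.wedge H (twistedIntegral hpr j n w) k x =
      H.wedge (fiberCoeff s n w) k x ⊗ₜ tpow (j.frame s x) n := by
    rw [TotalForm.wedge, TensorProduct.sum_tmul]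
    exact Finset.sum_congr rfl fun i _ => LinearMap.rTensor_tmul _ _ _ _
  change covDer hpr j Θ (twistedIntegral hpr j n w) k x
      - LForm.contract Y (twistedIntegral hpr j n w) k x
      + LForm.wedge H (twistedIntegral hpr j n w) k x = -twistedIntegral hpr j n _ k x
  rw [h1, h2, h3, ← TensorProduct.sub_tmul, ← TensorProduct.add_tmul,
    fiberCoeff_identity s hpr hΘ hlift hodd hx n hw, TensorProduct.neg_tmul]
  rfl

end Covariant

end ExoticForms

theorem theorem2p3
    {E : Type*} [NormedAddCommGroup E] [NormedSpace ℝ E] [FiniteDimensional ℝ E]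
    {M : Type*} [TopologicalSpace M] [ChartedSpace E M] [IsManifold 𝓘(ℝ, E) ∞ M]
    {E' : Type*} [NormedAddCommGroup E'] [NormedSpace ℝ E'] [FiniteDimensional ℝ E']
    {P : Type*} [TopologicalSpace P] [ChartedSpace E' P] [IsManifold 𝓘(ℝ, E') ∞ P]
    [MulAction Circle P] {pr : P → M} (hpr : IsPrincipalCircleBundle E E' pr)
    {L : M → Type*} [∀ x, NormedAddCommGroup (L x)] [∀ x, InnerProductSpace ℂ (L x)]
    [TopologicalSpace (TotalSpace ℂ L)] [FiberBundle ℂ L]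
    [VectorBundle ℂ ℂ L] [VectorBundle ℝ ℂ L] [ContMDiffVectorBundle ∞ ℂ L 𝓘(ℝ, E)]
    (j : CircleBundleIso E E' L pr)
    (Θ : Form E' P 1) (hΘ : IsConnectionForm Θ)
    (Y : M → E) (hY : IsSmoothVectorField Y)
    (Y' : P → E') (hY' : IsSmoothVectorField Y')
    (hlift : ∀ p : P, tangentMapAt pr p (Y' p) = Y (pr p))
    (H : TotalForm E M) (hH : H.IsSmooth) (hodd : ∀ k, Even k → H k = 0)
    (n : ℤ) (w : TotalForm E' P) (hw : w.IsSmooth) :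
    LForm.IsSmooth j (twistedIntegral hpr j n w) ∧
    (∀ (s : LocalSection E E' pr) (k : ℕ), ∀ x ∈ s.U,
      twistedIntegral hpr j n w k x = twistedIntegralIn j n s w k x) ∧
    (∀ (s : LocalSection E E' pr) (k : ℕ), ∀ x ∈ s.U,
      covDer hpr j Θ (twistedIntegral hpr j n w) k x =
        covDerIn j Θ s (twistedIntegral hpr j n w) k x) ∧
    covDer hpr j Θ (twistedIntegral hpr j n w)
        - LForm.contract Y (twistedIntegral hpr j n w)
        + LForm.wedge H (twistedIntegral hpr j n w)
      = -twistedIntegral hpr j n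
          (w.d + (n : ℂ) • oneWedge Θ w - w.contract Y' + (H.pullback pr).wedge w) := by
  refine ⟨isSmooth_twistedIntegral j hpr n hw, fun s k x hx => twistedIntegral_eq j s hpr hx n w k,
    fun s k x hx => ?_, covDer_sub_contract_add_wedge_twistedIntegral j hpr hΘ hlift hodd n hw⟩
  exact (covDerIn_twistedIntegral_eq_neg j _ hpr hΘ (hpr.mem_localSection x) n hw k).trans
    (covDerIn_twistedIntegral_eq_neg j s hpr hΘ hx n hw k).symm
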